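/- All graphs are finite and simple. For graphs $G_1,G_2$, the Ramsey number $R(G_1,G_2)$ is the least integer $r$ such that for every graph $G$ on $r$ vertices, either $G$ contains $G_1$ as a (not necessarily induced) subgraph or the complement $\overline{G}$ contains $G_2$ as a subgraph. Let $P_n$ be the path on $n$ vertices, and let $K_1\vee F$ be the graph obtained from $F$ by adding a new vertex joined to every vertex of $F$. A linear forest is a forest each component of which is a path (possibly a single vertex); it is non-empty if it has at least one edge. For integers $n,m\ge 2$ put $$\alpha=\frac{m-1}{n-1},\qquad \beta=\lceil\alpha\rceil,\qquad \gamma=\frac{\beta^2}{\beta+1},\qquad t(n,m)=\begin{cases}(n-1)\beta+1, & \alpha\le\gamma,\\ \lfloor (m-1)/\beta\rfloor+m, & \alpha>\gamma.\end{cases}$$ Let $F$ be a non-empty linear forest on $m$ vertices. Then $$R(P_n,K_1\vee F)=\begin{cases}2n-1, & 2\le m\le n,\\ t(n,m), & n\ge 2\text{ and } m\ge 2n.\end{cases}$$ -/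

import Mathlib

open scoped SimpleGraph

/-- `F` is a linear forest: a forest each component of which is a path. -/
def IsLinearForest {V : Type*} (F : SimpleGraph V) : Prop :=
  F.IsAcyclic ∧
    ∀ c : F.ConnectedComponent, ∃ k : ℕ, Nonempty (c.toSimpleGraph ≃g SimpleGraph.pathGraph k)

/-- The join `G ∨ H`: the disjoint union of `G` and `H` together with all edges between them. -/
def graphJoin {V W : Type*} (G : SimpleGraph V) (H : SimpleGraph W) : SimpleGraph (V ⊕ W) :=
  (G ⊕g H) ⊔ completeBipartiteGraph V W

/-- `r` is the Ramsey number `R(G₁, G₂)`: the least integer `r` such that for every graph `G` on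
`r` vertices, either `G` contains a copy of `G₁` or the complement of `G` contains a copy of `G₂`
(copies need not be induced). -/
def IsRamseyNumber {V W : Type*} (G₁ : SimpleGraph V) (G₂ : SimpleGraph W) (r : ℕ) : Prop :=
  IsLeast {r : ℕ | ∀ G : SimpleGraph (Fin r), G₁ ⊑ G ∨ G₂ ⊑ Gᶜ} r

/-- The number `α = (m - 1) / (n - 1)`, for `n, m ≥ 2`. -/
def quasarAlpha (n m : ℕ) : ℚ := ((m : ℚ) - 1) / ((n : ℚ) - 1)

/-- The number `β = ⌈α⌉`. -/
def quasarBeta (n m : ℕ) : ℕ := ⌈quasarAlpha n m⌉₊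

/-- The number `γ = β² / (β + 1)`. -/
def quasarGamma (n m : ℕ) : ℚ := (quasarBeta n m : ℚ) ^ 2 / ((quasarBeta n m : ℚ) + 1)

/-- The number `t(n, m)`, for `n, m ≥ 2`. -/
def quasarT (n m : ℕ) : ℕ :=
  if quasarAlpha n m ≤ quasarGamma n m then (n - 1) * quasarBeta n m + 1
  else ⌊((m : ℚ) - 1) / (quasarBeta n m : ℚ)⌋₊ + m

/-!
Write `N(x)` for the neighbourhood of `x`. A linear forest on `m` vertices is a subgraph of the path
on `m` vertices (`IsLinearForest.exists_list`), so for the upper bounds it suffices to find, in a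
graph `G` without a path on `n` vertices, a hub `v` whose non-neighbours contain a path on `m`
vertices of the complement.

Upper bound for `m ≥ 2 * n`. By Ore's argument and the Bondy–Chvátal closure
(`hamiltonian_or_dense`), the complement of `G` restricted to a set `S` of at least `2 * n` vertices
has a Hamiltonian path unless there is a set `D ⊆ S` of fewer than `n / 2` vertices, each adjacent to
all but fewer than `|D|` others of `S`. If all components of `G` have fewer than `n` vertices, such
`D` cannot exist, and a vertex of small degree, found by counting components, is a hub. Otherwise
choose an obstruction `D` with `|D|` maximal, and let `Z` consist of `D` and all vertices with at most
`n - 2` non-neighbours. Any two vertices of `Z` have so many common neighbours that `Z` lies on a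
path without two consecutive vertices in `Z` (`IsObstruction.exists_path_through`). Rotating a longest
such path yields an end `e` for which `U = |N(e) ∪ Z|` satisfies `3 * U ≤ 2 * n - 4` and
`U + |Z| ≤ n - 2` (`exists_end`). The first bound leaves at least `m` vertices outside
`{e} ∪ N(e) ∪ Z`. A further obstruction `D'` among these has `|D'| ≤ |D| ≤ |Z|` by maximality, and
then the second bound shows that the vertices of `D'` have at most `n - 2` non-neighbours, so that
they lie in `Z`, which is absurd. Hence `e` is a hub.

Upper bound for `m ≤ n`. A vertex of degree at most `n / 2 - 1` is a hub by the diagonal path Ramsey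
theorem of Gerencsér and Gyárfás (`exists_monochromatic_path`). If there is none, `exists_end` shows
that every component has fewer than `n` vertices, while each has at least `n / 2`; so there are
three components, and a path of the complement alternates between two of them, avoiding the third.

Lower bounds. Disjoint unions of cliques of nearly equal sizes, with at most `n - 1` vertices each
(`modGraph`), have no path on `n` vertices. With `β` or `β + 1` cliques the complement has degrees
below `m`; with two cliques it is bipartite and so contains no triangle.
-/

/-! ### Paths as lists of vertices -/

/-- A path of `G`, encoded as the list of its vertices: consecutive entries are adjacent and no
vertex is repeated. The empty list is allowed. -/
def IsPathList {V : Type*} (G : SimpleGraph V) (l : List V) : Prop :=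
  l.IsChain G.Adj ∧ l.Nodup

open Classical in
/-- The neighbourhood of `v` in `G` as a `Finset`. -/
noncomputable def nbr {V : Type*} [Fintype V] (G : SimpleGraph V) (v : V) : Finset V :=
  Finset.univ.filter (G.Adj v)

section Lists

variable {V : Type*} {G : SimpleGraph V}

@[simp] lemma mem_nbr [Fintype V] {u v : V} : u ∈ nbr G v ↔ G.Adj v u := by
  simp [nbr]

lemma isChain_reverse_of_symm {R : V → V → Prop} (hR : ∀ a b, R a b → R b a) {l : List V}
    (h : l.IsChain R) : l.reverse.IsChain R := by
  rw [List.isChain_reverse]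
  exact h.imp fun a b hab => hR a b hab

lemma IsPathList.reverse {l : List V} (h : IsPathList G l) : IsPathList G l.reverse :=
  ⟨isChain_reverse_of_symm (fun _ _ h => h.symm) h.1, List.nodup_reverse.2 h.2⟩

lemma IsPathList.cons {l : List V} {u : V} (h : IsPathList G l) (hu : u ∉ l)
    (hadj : ∀ y ∈ l.head?, G.Adj u y) : IsPathList G (u :: l) :=
  ⟨List.isChain_cons.2 ⟨hadj, h.1⟩, List.nodup_cons.2 ⟨hu, h.2⟩⟩

lemma IsPathList.mono {H : SimpleGraph V} (hHG : H ≤ G) {l : List V} (h : IsPathList H l) :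
    IsPathList G l :=
  ⟨h.1.imp fun _ _ hab => hHG hab, h.2⟩

lemma IsPathList.take {l : List V} (h : IsPathList G l) (k : ℕ) : IsPathList G (l.take k) :=
  ⟨h.1.take k, h.2.sublist (List.take_sublist _ _)⟩

/-- Reversing a segment `B` of a path `A ++ B ++ C` gives a path again, provided the two new
junctions are edges. -/
lemma IsPathList.reverse_segment {A B C : List V}
    (hA : A.IsChain G.Adj) (hB : B.IsChain G.Adj) (hC : C.IsChain G.Adj)
    (hnd : (A ++ B ++ C).Nodup) (hBne : B ≠ [])
    (h₁ : ∀ x ∈ A.getLast?, ∀ y ∈ B.getLast?, G.Adj x y)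
    (h₂ : ∀ x ∈ B.head?, ∀ y ∈ C.head?, G.Adj x y) :
    IsPathList G (A ++ B.reverse ++ C) := by
  refine ⟨?_, ?_⟩
  · rw [List.isChain_append, List.isChain_append]
    refine ⟨⟨hA, isChain_reverse_of_symm (fun _ _ h => h.symm) hB, ?_⟩, hC, ?_⟩
    · simpa [List.head?_reverse] using h₁
    · intro x hx y hy
      have : (A ++ B.reverse).getLast? = B.head? := by
        rw [List.getLast?_append, List.getLast?_reverse]
        cases B <;> simp_all
      exact h₂ x (this ▸ hx) y hy
  · refine (List.Perm.nodup_iff ?_).1 hnd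
    exact ((List.reverse_perm B).symm.append_left A).append_right C

/-- Cutting a closed path at `v` and prepending an outside neighbour of `v`. -/
lemma IsPathList.cons_rotate {L₁ L₂ : List V} {u v : V} (h : IsPathList G (L₁ ++ v :: L₂))
    (hclosed : ∀ x ∈ (L₁ ++ v :: L₂).getLast?, ∀ y ∈ (L₁ ++ v :: L₂).head?, x = y ∨ G.Adj x y)
    (huv : G.Adj u v) (hu : u ∉ L₁ ++ v :: L₂) : IsPathList G (u :: (v :: L₂ ++ L₁)) := by
  have hc := List.isChain_append.1 h.1
  have hp : (v :: L₂ ++ L₁).Perm (L₁ ++ v :: L₂) := List.perm_append_comm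
  refine ⟨List.isChain_cons.2 ⟨by simpa using huv, List.isChain_append.2 ⟨hc.2.1, hc.1, ?_⟩⟩,
    List.nodup_cons.2 ⟨fun hm => hu (hp.subset hm), hp.nodup_iff.2 h.2⟩⟩
  intro x hx y hy
  have hx' : x ∈ (L₁ ++ v :: L₂).getLast? := by
    rw [List.getLast?_append]
    simp only [Option.mem_def] at hx
    simp [hx]
  have hy' : y ∈ (L₁ ++ v :: L₂).head? := by
    rw [List.head?_append]
    simp only [Option.mem_def] at hy
    simp [hy]
  rcases hclosed x hx' y hy' with rfl | h'
  · exfalso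
    have h1 : x ∈ v :: L₂ := List.mem_of_getLast? hx
    have h2 : x ∈ L₁ := List.mem_of_head? hy
    exact (List.nodup_append.1 h.2).2.2 x h2 x h1 rfl
  · exact h'

lemma exists_longest {p : List V → Prop} (h : ∃ l, p l) {n : ℕ} (hb : ∀ l, p l → l.length < n) :
    ∃ l, p l ∧ ∀ l', p l' → l'.length ≤ l.length := by
  classical
  obtain ⟨l₀, h₀⟩ := h
  have hex : ∃ k, (∃ l, p l ∧ l.length = k) ∧ k ≤ n :=
    ⟨_, ⟨l₀, h₀, rfl⟩, (hb _ h₀).le⟩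
  have hs := Nat.findGreatest_spec (P := fun k => ∃ l, p l ∧ l.length = k) (n := n)
    (hb _ h₀).le ⟨l₀, h₀, rfl⟩
  obtain ⟨l, hl, hlen⟩ := hs
  refine ⟨l, hl, fun l' hl' => ?_⟩
  rw [hlen]
  exact Nat.le_findGreatest (hb _ hl').le ⟨l', hl', rfl⟩

open Classical in
lemma card_eq_countP {l : List V} (hl : l.Nodup) {S : Finset V} (hS : ∀ x ∈ S, x ∈ l) :
    S.card = l.countP (· ∈ S) := by
  rw [List.countP_eq_length_filter, ← List.toFinset_card_of_nodup (hl.filter _)]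
  congr 1
  ext x
  simp only [List.mem_toFinset, List.mem_filter, decide_eq_true_eq]
  exact ⟨fun h => ⟨hS x h, h⟩, fun h => h.2⟩

open Classical in
lemma countP_add_countP_le (S T : Finset V) : ∀ (a : V) (l : List V),
    (∀ x ∈ (a :: l).getLast?, x ∉ S) → (a :: l).IsChain (fun u v => ¬(u ∈ S ∧ v ∈ T)) →
    (a :: l).countP (· ∈ S) + (a :: l).countP (· ∈ T) ≤ l.length + if a ∈ T then 1 else 0
  | a, [], hlast, _ => by
    have : a ∉ S := hlast a (by simp)
    simp [List.countP_cons, this]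
  | a, b :: l, hlast, hch => by
    have ih := countP_add_countP_le S T b l (by simpa [List.getLast?_cons_cons] using hlast)
      (List.isChain_cons_cons.1 hch).2
    have hab := (List.isChain_cons_cons.1 hch).1
    rw [List.countP_cons (a := a), List.countP_cons (a := a)]
    by_cases h1 : a ∈ S <;> by_cases h2 : a ∈ T <;> by_cases h3 : b ∈ T <;> simp_all <;> omega

/-- The counting principle behind all rotation arguments: two sets `S`, `T` of vertices of a path
such that no vertex of `S` is followed immediately by a vertex of `T`. Shifting `S` by one place
makes it disjoint from `T`. -/
lemma card_add_card_le {l : List V} (hl : l.Nodup) (hne : l ≠ []) {S T : Finset V}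
    (hS : ∀ x ∈ S, x ∈ l) (hT : ∀ x ∈ T, x ∈ l) (hlast : ∀ x ∈ l.getLast?, x ∉ S)
    (hhead : ∀ x ∈ l.head?, x ∉ T)
    (h : ∀ l₁ u v l₂, l = l₁ ++ u :: v :: l₂ → u ∈ S → v ∉ T) :
    S.card + T.card + 1 ≤ l.length := by
  rw [card_eq_countP hl hS, card_eq_countP hl hT]
  cases l with
  | nil => exact absurd rfl hne
  | cons a l =>
    have := countP_add_countP_le S T a l hlast (by
      rw [List.isChain_iff_forall_rel_of_append_cons_cons]
      intro u v l₁ l₂ he huv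
      exact h l₁ u v l₂ he huv.1 huv.2)
    rw [if_neg (hhead a (by simp))] at this
    simp only [List.length_cons]
    omega

end Lists

/-! ### Ends of longest paths -/

section Ends

variable {V : Type*}

/-- `G` without the edges inside `Z`. Its paths are the paths of `G` on which no two vertices of
`Z` are consecutive. -/
def deleteInside (G : SimpleGraph V) (Z : Finset V) : SimpleGraph V where
  Adj a b := G.Adj a b ∧ ¬(a ∈ Z ∧ b ∈ Z)
  symm.symm _ _ h := ⟨h.1.symm, fun h' => h.2 ⟨h'.2, h'.1⟩⟩
  loopless.irrefl a h := G.loopless.irrefl a h.1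

lemma deleteInside_le (G : SimpleGraph V) (Z : Finset V) : deleteInside G Z ≤ G :=
  fun _ _ h => h.1

/-- `l` is a longest path among the paths of `G` that contain `R` and have no two consecutive
vertices in `Z`. -/
structure IsLongestThrough (G : SimpleGraph V) (Z R : Finset V) (l : List V) : Prop where
  path : IsPathList (deleteInside G Z) l
  through : ∀ x ∈ R, x ∈ l
  longest : ∀ l', IsPathList (deleteInside G Z) l' → (∀ x ∈ R, x ∈ l') → l'.length ≤ l.length

namespace IsLongestThrough

variable {G : SimpleGraph V} {Z R : Finset V} {l : List V}

lemma reverse (h : IsLongestThrough G Z R l) : IsLongestThrough G Z R l.reverse :=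
  ⟨h.path.reverse, by simpa using h.through, by simpa using h.longest⟩

/-- A rearrangement of a longest path into another path is a longest path. -/
lemma of_perm (h : IsLongestThrough G Z R l) {l' : List V}
    (hl' : IsPathList (deleteInside G Z) l') (hp : l'.Perm l) : IsLongestThrough G Z R l' :=
  ⟨hl', fun x hx => hp.mem_iff.2 (h.through x hx), fun l'' h₁ h₂ => by
    rw [hp.length_eq]; exact h.longest l'' h₁ h₂⟩

lemma mem_of_adj_head (h : IsLongestThrough G Z R l) (hZR : Z ⊆ R) {e u : V}
    (he : e ∈ l.head?) (hu : G.Adj e u) : u ∈ l := by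
  by_contra hul
  have huZ : u ∉ Z := fun hz => hul (h.through u (hZR hz))
  have := h.longest (u :: l) (h.path.cons hul (by
    intro y hy
    have : e = y := by simp_all
    subst this
    exact ⟨hu.symm, fun hh => huZ hh.1⟩)) (fun x hx => List.mem_cons_of_mem _ (h.through x hx))
  simp at this

/-- Rotation: if the first vertex `e` is adjacent to `v`, the predecessor `u` of `v` is the first
vertex of another longest path on the same vertices. -/
lemma rotate {A C : List V} {e u v : V} (h : IsLongestThrough G Z R (A ++ u :: v :: C))
    (he : e ∈ (A ++ u :: v :: C).head?) (hev : G.Adj e v) (heZ : e ∉ Z) :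
    IsLongestThrough G Z R ((A ++ [u]).reverse ++ v :: C) := by
  have hc := List.isChain_append_cons_cons.1 h.path.1
  refine h.of_perm ?_ ?_
  · have := IsPathList.reverse_segment (G := deleteInside G Z) (A := []) (B := A ++ [u])
      (C := v :: C) List.isChain_nil hc.1 hc.2.2 (by simpa using h.path.2) (by simp) (by simp) (by
        intro x hx y hy
        have hx' : x = e := by cases A <;> simp_all
        have hy' : y = v := by simp_all
        subst hx' hy'
        exact ⟨hev, fun hh => heZ hh.1⟩)
    simpa using this
  · have := ((List.reverse_perm (A ++ [u])).append_right (v :: C))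
    simpa using this

variable [Fintype V]

/-- The crossing and rotation bounds for the two ends `a`, `b` of a longest path through `R`. The
hypothesis `hout` says that every vertex of `Z` has a neighbour off each path of this length, and
`hext` that some vertex of the path has one, so that no path of maximal length closes up to a
cycle. -/
lemma card_ends [DecidableEq V] (h : IsLongestThrough G Z R l) (hZR : Z ⊆ R)
    (hout : ∀ l', IsLongestThrough G Z R l' → ∀ z ∈ Z, ∃ u, u ∉ l' ∧ G.Adj z u)
    (hext : ∃ v ∈ l, ∃ u, u ∉ l ∧ G.Adj v u) {a b : V} (ha : a ∈ l.head?) (hb : b ∈ l.getLast?) :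
    b ∉ Z ∧ (nbr G a).card + (nbr G b ∪ Z).card + 1 ≤ l.length ∧
      (nbr G b ∪ Z).card + Z.card + 1 ≤ l.length := by
  have hne : l ≠ [] := by rintro rfl; simp at ha
  have hend : ∀ l', IsLongestThrough G Z R l' → ∀ x ∈ l'.head?, x ∉ Z := by
    intro l' hl' x hx hxZ
    obtain ⟨u, hu, hxu⟩ := hout l' hl' x hxZ
    exact hu (hl'.mem_of_adj_head hZR hx hxu)
  have hbr : b ∈ l.reverse.head? := by simpa using hb
  have haZ := hend l h a ha
  have hbZ := hend _ h.reverse b hbr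
  have hSub : ∀ x ∈ nbr G b ∪ Z, x ∈ l := by
    intro x hx
    rcases Finset.mem_union.1 hx with hx | hx
    · have := h.reverse.mem_of_adj_head hZR hbr (mem_nbr.1 hx)
      simpa using this
    · exact h.through x (hZR hx)
  have hlastS : ∀ x ∈ l.getLast?, x ∉ nbr G b ∪ Z := by
    intro x hx
    have : x = b := by simp_all
    subst this
    simp [hbZ]
  refine ⟨hbZ, ?_, ?_⟩
  · rw [add_comm (nbr G a).card]
    refine card_add_card_le h.path.2 hne hSub
      (fun x hx => h.mem_of_adj_head hZR ha (mem_nbr.1 hx)) hlastS ?_ ?_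
    · intro x hx
      have : x = a := by simp_all
      subst this
      simp
    · rintro A u v C rfl hu hv
      rw [mem_nbr] at hv
      have hrot := h.rotate ha hv haZ
      have huh : u ∈ ((A ++ [u]).reverse ++ v :: C).head? := by simp
      have huZ := hend _ hrot u huh
      have hub : G.Adj b u := by simpa [huZ] using hu
      -- the rotated path closes up to a cycle, which can be opened next to an outside vertex
      obtain ⟨x, hx, y, hy, hxy⟩ := hext
      have hperm : ((A ++ [u]).reverse ++ v :: C).Perm (A ++ u :: v :: C) := by
        have := ((List.reverse_perm (A ++ [u])).append_right (v :: C))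
        simpa using this
      have hx' : x ∈ (A ++ [u]).reverse ++ v :: C := hperm.mem_iff.2 hx
      have hy' : y ∉ (A ++ [u]).reverse ++ v :: C := fun hh => hy (hperm.mem_iff.1 hh)
      obtain ⟨L₁, L₂, hL⟩ := List.append_of_mem hx'
      have hlast : ((A ++ [u]).reverse ++ v :: C).getLast? = some b := by
        rw [← Option.mem_def.1 hb]
        rw [show A ++ u :: v :: C = (A ++ [u]) ++ v :: C by simp, List.getLast?_append,
          List.getLast?_append]
        simp [List.getLast?_cons]
      rw [hL] at hlast huh hy' hrot hperm
      have hyZ : y ∉ Z := fun hh => hy (h.through y (hZR hh))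
      have hpath := hrot.path.cons_rotate (u := y) (v := x) (by
        intro s hs t ht
        have h1 : s = b := by simp_all
        have h2 : t = u := by simp_all
        subst h1 h2
        exact Or.inr ⟨hub, fun hh => hbZ hh.1⟩) ⟨hxy.symm, fun hh => hyZ hh.1⟩ hy'
      have hpe : (x :: L₂ ++ L₁).Perm (L₁ ++ x :: L₂) := List.perm_append_comm
      have hlen := hrot.longest _ hpath (fun r hr => List.mem_cons_of_mem _
        (hpe.mem_iff.2 (hrot.through r hr)))
      rw [List.length_cons, hpe.length_eq] at hlen
      omega
  · refine card_add_card_le h.path.2 hne hSub (fun x hx => h.through x (hZR hx)) hlastS ?_ ?_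
    · intro x hx
      exact hend l h x hx
    · rintro A u v C rfl hu hv
      rcases Finset.mem_union.1 hu with hu | hu
      · rw [mem_nbr] at hu
        have hrev : (A ++ u :: v :: C).reverse = C.reverse ++ v :: u :: A.reverse := by simp
        have hr := h.reverse
        rw [hrev] at hr hbr
        exact hend _ (hr.rotate hbr hu hbZ) v (by simp) hv
      · exact (List.isChain_append_cons_cons.1 h.path.1).2.1.2 ⟨hu, hv⟩

end IsLongestThrough

/-- A vertex of degree at least `n - 1` on a path with fewer than `n` vertices has a neighbour off
the path. -/
lemma exists_adj_notMem [Fintype V] {G : SimpleGraph V} {n : ℕ} {l : List V} (hl : l.length < n)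
    {z : V} (hz : z ∈ l) (hdeg : n - 1 ≤ (nbr G z).card) : ∃ u, u ∉ l ∧ G.Adj z u := by
  classical
  by_contra! hcon
  have hsub : insert z (nbr G z) ⊆ l.toFinset := by
    intro x hx
    rw [List.mem_toFinset]
    rcases Finset.mem_insert.1 hx with rfl | hx
    · exact hz
    · by_contra hx'
      exact hcon x hx' (mem_nbr.1 hx)
  have h1 := Finset.card_le_card hsub
  rw [Finset.card_insert_of_notMem (by simp)] at h1
  have := l.toFinset_card_le
  omega

/-- Suppose `G` has no path on `n` vertices, and some path of `G` contains `R ⊇ Z` with no two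
consecutive vertices in `Z`. If the vertices of `Z` have degree at least `n - 1`, and every path
containing `R` has an edge leaving it, then for an end `e` of a suitable longest path the set
`N(e) ∪ Z` is small. With `p` the number of vertices of the path, `a ≥ |N(e)|` the degree of its
other end and `U = |N(e) ∪ Z|`, the bounds are `U + a < p`, `U + |Z| < p` and `U ≤ a + |Z|`, and
adding them gives `3 * U ≤ 2 * (p - 1)`. -/
lemma exists_end [Fintype V] [DecidableEq V] {G : SimpleGraph V} {n : ℕ}
    (hfree : ∀ l, IsPathList G l → l.length < n) {Z R : Finset V} (hZR : Z ⊆ R)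
    (hdeg : ∀ z ∈ Z, n - 1 ≤ (nbr G z).card)
    (hext : ∀ l, IsPathList G l → (∀ x ∈ R, x ∈ l) → ∃ v ∈ l, ∃ u, u ∉ l ∧ G.Adj v u)
    (hex : ∃ l, IsPathList (deleteInside G Z) l ∧ ∀ x ∈ R, x ∈ l) :
    ∃ e, e ∉ Z ∧ 2 * (nbr G e).card + 2 ≤ n ∧ (nbr G e ∪ Z).card + Z.card + 2 ≤ n ∧
      3 * (nbr G e ∪ Z).card + 4 ≤ 2 * n := by
  have hfree' : ∀ l, IsPathList (deleteInside G Z) l → l.length < n :=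
    fun l hl => hfree l (hl.mono (deleteInside_le G Z))
  obtain ⟨l, ⟨hl, hRl⟩, hmax⟩ := exists_longest (n := n)
    (p := fun l => IsPathList (deleteInside G Z) l ∧ ∀ x ∈ R, x ∈ l) hex
    (fun l hl => hfree' l hl.1)
  have h : IsLongestThrough G Z R l := ⟨hl, hRl, fun l' h₁ h₂ => hmax l' ⟨h₁, h₂⟩⟩
  have hout : ∀ l', IsLongestThrough G Z R l' → ∀ z ∈ Z, ∃ u, u ∉ l' ∧ G.Adj z u := by
    intro l' hl' z hz
    exact exists_adj_notMem (hfree' _ hl'.path) (hl'.through _ (hZR hz)) (hdeg z hz)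
  -- orient the path so that its last vertex has the smaller degree
  have key : ∀ l, IsLongestThrough G Z R l → ∀ a ∈ l.head?, ∀ b ∈ l.getLast?,
      (nbr G b).card ≤ (nbr G a).card →
      ∃ e, e ∉ Z ∧ 2 * (nbr G e).card + 2 ≤ n ∧ (nbr G e ∪ Z).card + Z.card + 2 ≤ n ∧
      3 * (nbr G e ∪ Z).card + 4 ≤ 2 * n := by
    intro l h a ha b hb hab
    obtain ⟨h1, h2, h3⟩ := h.card_ends hZR hout
      (hext l (h.path.mono (deleteInside_le G Z)) h.through) ha hb
    have h4 := hfree' _ h.path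
    have h5 := Finset.card_union_le (nbr G b) Z
    have h6 := Finset.card_le_card (Finset.subset_union_left (s₁ := nbr G b) (s₂ := Z))
    exact ⟨b, h1, by omega, by omega, by omega⟩
  have hne : l ≠ [] := by
    rintro rfl
    obtain ⟨v, hv, -⟩ := hext [] ⟨List.isChain_nil, List.nodup_nil⟩ hRl
    simp at hv
  have ha : l.head hne ∈ l.head? := by simp [List.head?_eq_some_head hne]
  have hb : l.getLast hne ∈ l.getLast? := by simp [List.getLast?_eq_some_getLast hne]
  rcases le_total (nbr G (l.getLast hne)).card (nbr G (l.head hne)).card with hle | hle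
  · exact key l h _ ha _ hb hle
  · exact key l.reverse h.reverse _ (by simpa using hb) _ (by simpa using ha) hle

end Ends

/-! ### Hamiltonian paths in the complement -/

section Hamiltonian

variable {V : Type*}

lemma deleteInside_empty (G : SimpleGraph V) : deleteInside G ∅ = G := by
  ext a b
  simp [deleteInside]

lemma isChain_compl_of_delete {H K : SimpleGraph V} {v : V} {l : List V}
    (hK : ∀ a b, a ≠ v → b ≠ v → Kᶜ.Adj a b → Hᶜ.Adj a b)
    (hl : l.IsChain Kᶜ.Adj) (hv : v ∉ l) : l.IsChain Hᶜ.Adj := by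
  rw [List.isChain_iff_forall_rel_of_append_cons_cons] at hl ⊢
  rintro a b l₁ l₂ rfl
  refine hK a b ?_ ?_ (hl rfl)
  · rintro rfl; simp at hv
  · rintro rfl; simp at hv

variable [Fintype V]

lemma card_nbr_compl (G : SimpleGraph V) (v : V) :
    (nbr Gᶜ v).card + (nbr G v).card + 1 = Fintype.card V := by
  classical
  have h : (nbr Gᶜ v) = Finset.univ \ insert v (nbr G v) := by
    ext x
    simp [SimpleGraph.compl_adj, eq_comm]
  have h2 := Finset.card_sdiff_add_card_eq_card (Finset.subset_univ (insert v (nbr G v)))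
  rw [← h, Finset.card_insert_of_notMem (by simp), Finset.card_univ] at h2
  omega

lemma card_nbr_le_of_le {G H : SimpleGraph V} (h : G ≤ H) (v : V) :
    (nbr G v).card ≤ (nbr H v).card :=
  Finset.card_le_card fun x hx => by
    rw [mem_nbr] at hx ⊢
    exact h hx

/-- Ore's argument: let the two paths `A ++ [u]` and `v :: C` of `Hᶜ` cover all vertices. If `Hᶜ`
has no Hamiltonian path, then the degrees of `u` and `v` in `H` sum to at least the number of
vertices. -/
lemma card_le_of_split {H : SimpleGraph V} (hno : ¬∃ l, IsPathList Hᶜ l ∧ ∀ x, x ∈ l)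
    {A C : List V} {u v : V} (hA : (A ++ [u]).IsChain Hᶜ.Adj) (hC : (v :: C).IsChain Hᶜ.Adj)
    (hnd : (A ++ u :: v :: C).Nodup) (hall : ∀ x, x ∈ A ++ u :: v :: C) (huv : H.Adj u v) :
    Fintype.card V ≤ (nbr H u).card + (nbr H v).card := by
  classical
  have hlen : (A ++ u :: v :: C).length = Fintype.card V := by
    rw [← List.toFinset_card_of_nodup hnd, ← Finset.card_univ]
    congr 1
    ext x
    simp only [List.mem_toFinset, Finset.mem_univ, iff_true]
    exact hall x
  -- reversing any segment whose two new junctions are edges would give a Hamiltonian path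
  have hrev : ∀ A' B' C' : List V, A' ++ B' ++ C' = A ++ u :: v :: C → A'.IsChain Hᶜ.Adj →
      B'.IsChain Hᶜ.Adj → C'.IsChain Hᶜ.Adj → B' ≠ [] →
      (∀ x ∈ A'.getLast?, ∀ y ∈ B'.getLast?, Hᶜ.Adj x y) →
      (∀ x ∈ B'.head?, ∀ y ∈ C'.head?, Hᶜ.Adj x y) → False := by
    intro A' B' C' he hA' hB' hC' hne h₁ h₂
    refine hno ⟨_, IsPathList.reverse_segment hA' hB' hC' (he ▸ hnd) hne h₁ h₂, fun x => ?_⟩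
    have := hall x
    rw [← he] at this
    simp only [List.mem_append, List.mem_reverse] at this ⊢
    exact this
  have huv' : ¬Hᶜ.Adj u v := fun h => (SimpleGraph.compl_adj _ _ _).1 h |>.2 huv
  have hvu' : ¬Hᶜ.Adj v u := fun h => huv' h.symm
  have hnd' := List.nodup_append.1 hnd
  have huC : u ∉ v :: C := (List.nodup_cons.1 hnd'.2.1).1
  have hvA : v ∉ A := fun h => hnd'.2.2 v h v (by simp) rfl
  have hcount := card_add_card_le (l := A ++ u :: v :: C) hnd (by simp)
    (S := nbr Hᶜ u) (T := insert v (nbr Hᶜ v)) (fun x _ => hall x) (fun x _ => hall x) ?_ ?_ ?_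
  · rw [Finset.card_insert_of_notMem (by simp), hlen] at hcount
    have h1 := card_nbr_compl H u
    have h2 := card_nbr_compl H v
    omega
  · intro x hx hxu
    rw [mem_nbr] at hxu
    refine hrev (A ++ [u]) (v :: C) [] (by simp) hA hC List.isChain_nil (by simp) ?_ (by simp)
    intro s hs t ht
    have h1 : s = u := by simp_all
    have h2 : t = x := by
      rw [show A ++ u :: v :: C = (A ++ [u]) ++ v :: C by simp, List.getLast?_append] at hx
      rw [Option.mem_def] at ht hx
      rw [ht] at hx
      simpa using hx
    subst h1 h2
    exact hxu
  · intro x hx hxv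
    rcases Finset.mem_insert.1 hxv with rfl | hxv
    · have h1 : x ∈ (A ++ [u]).head? := by cases A <;> simp_all
      have h2 := List.mem_of_head? h1
      simp only [List.mem_append, List.mem_singleton] at h2
      rcases h2 with h2 | h2
      · exact hvA h2
      · exact huC (by simp [h2])
    · rw [mem_nbr] at hxv
      refine hrev [] (A ++ [u]) (v :: C) (by simp) List.isChain_nil hA hC (by simp) (by simp) ?_
      intro s hs t ht
      have h1 : s = x := by cases A <;> simp_all
      have h2 : t = v := by simp_all
      subst h1 h2
      exact hxv.symm
  · intro L₁ p q L₂ he hp hq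
    rw [mem_nbr] at hp
    rcases List.append_eq_append_iff.1 he with ⟨t, h1, h2⟩ | ⟨t, h1, h2⟩
    · -- `L₁ = A ++ t`
      match t, h2 with
      | [], h2 =>
        simp only [List.nil_append, List.cons.injEq] at h2
        rw [← h2.1] at hp
        simp at hp
      | [s], h2 =>
        simp only [List.cons_append, List.nil_append, List.cons.injEq] at h2
        rw [← h2.2.1] at hp
        exact huv' hp
      | s :: s' :: t, h2 =>
        simp only [List.cons_append, List.cons.injEq] at h2
        obtain ⟨rfl, rfl, rfl⟩ := h2
        have hqv : q ≠ v := by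
          rintro rfl
          have := (List.nodup_cons.1 (List.nodup_cons.1 hnd'.2.1).2).1
          simp at this
        have hq' : Hᶜ.Adj v q := by simpa [hqv] using hq
        rw [← List.cons_append, List.isChain_append_cons_cons] at hC
        refine hrev (A ++ [u]) (v :: t ++ [p]) (q :: L₂) (by simp) hA hC.1 hC.2.2 (by simp) ?_ ?_
        · intro x hx y hy
          have h1 : x = u := by simpa using hx.symm
          have h2 : y = p := by
            rw [List.getLast?_append] at hy
            simpa using hy.symm
          rw [h1, h2]
          exact hp
        · intro x hx y hy
          have h1 : x = v := by simpa using hx.symm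
          have h2 : y = q := by simpa using hy.symm
          rw [h1, h2]
          exact hq'
    · -- `A = L₁ ++ t`
      match t, h2 with
      | [], h2 =>
        simp only [List.nil_append, List.cons.injEq] at h2
        rw [h2.1] at hp
        simp at hp
      | [s], h2 =>
        simp only [List.cons_append, List.nil_append, List.cons.injEq] at h2
        obtain ⟨rfl, rfl, rfl⟩ := h2
        have : q ≠ v := fun h => huC (by simp [h])
        exact hvu' (by simpa [this] using hq)
      | s :: s' :: t, h2 =>
        simp only [List.cons_append, List.cons.injEq] at h2
        obtain ⟨rfl, rfl, rfl⟩ := h2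
        have hqv : q ≠ v := by
          rintro rfl
          exact hvA (h1 ▸ by simp)
        have hq' : Hᶜ.Adj v q := by simpa [hqv] using hq
        subst h1
        rw [show L₁ ++ p :: q :: t ++ [u] = L₁ ++ p :: q :: (t ++ [u]) by simp,
          List.isChain_append_cons_cons] at hA
        refine hrev (L₁ ++ [p]) (q :: (t ++ [u])) (v :: C) (by simp) hA.1 hA.2.2 hC (by simp) ?_ ?_
        · intro x hx y hy
          have h1 : x = p := by simpa using hx.symm
          have h2 : y = u := by
            rw [← List.cons_append, List.getLast?_append] at hy
            simpa using hy.symm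
          rw [h1, h2]
          exact hp.symm
        · intro x hx y hy
          have h1 : x = q := by simpa using hx.symm
          have h2 : y = v := by simpa using hy.symm
          rw [h1, h2]
          exact hq'.symm

/-- If `Hᶜ` has no Hamiltonian path then neither has the complement of a subgraph of `H` in which
adjacent vertices have degree sum at least the number of vertices: this is the Bondy–Chvátal
closure, obtained here as a minimal subgraph of `H` whose complement has no Hamiltonian path. -/
lemma exists_closed_subgraph {H : SimpleGraph V} (hno : ¬∃ l, IsPathList Hᶜ l ∧ ∀ x, x ∈ l) :
    ∃ K ≤ H, (∃ u v, K.Adj u v) ∧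
      ∀ u v, K.Adj u v → Fintype.card V ≤ (nbr K u).card + (nbr K v).card := by
  classical
  obtain ⟨K, hK⟩ := Set.Finite.exists_minimal
    (s := {K : SimpleGraph V | K ≤ H ∧ ¬∃ l, IsPathList Kᶜ l ∧ ∀ x, x ∈ l}) (Set.toFinite _)
    ⟨H, le_rfl, hno⟩
  obtain ⟨hKH, hKno⟩ := hK.prop
  refine ⟨K, hKH, ?_, ?_⟩
  · by_contra! hcon
    refine hKno ⟨Finset.univ.toList, ⟨?_, Finset.nodup_toList _⟩, by simp⟩
    refine List.Pairwise.isChain ((Finset.nodup_toList _).imp fun {a b} hab => ?_)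
    exact (SimpleGraph.compl_adj _ _ _).2 ⟨hab, hcon a b⟩
  · intro u v huv
    set K' := K.deleteEdges {s(u, v)} with hK'
    have hlt : ¬K ≤ K' := fun hle => by
      have := hle huv
      simp [hK'] at this
    have hK'K : K' ≤ K := SimpleGraph.deleteEdges_le _
    have hex : ∃ l, IsPathList K'ᶜ l ∧ ∀ x, x ∈ l := by
      by_contra hcon
      exact hlt (hK.le_of_le ⟨hK'K.trans hKH, hcon⟩ hK'K)
    obtain ⟨l, hl, hall⟩ := hex
    have hcompl : ∀ a b, K'ᶜ.Adj a b → Kᶜ.Adj a b ∨ (a = u ∧ b = v) ∨ (a = v ∧ b = u) := by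
      intro a b hab
      rw [SimpleGraph.compl_adj, hK', SimpleGraph.deleteEdges_adj] at hab
      rw [SimpleGraph.compl_adj]
      by_cases h : K.Adj a b
      · right
        by_contra hcon
        exact hab.2 ⟨h, by simpa using hcon⟩
      · exact Or.inl ⟨hab.1, h⟩
    have hu : ∀ a b, a ≠ u → b ≠ u → K'ᶜ.Adj a b → Kᶜ.Adj a b := by
      intro a b ha hb h
      rcases hcompl a b h with h | h | h
      · exact h
      · exact absurd h.1 ha
      · exact absurd h.2 hb
    have hv : ∀ a b, a ≠ v → b ≠ v → K'ᶜ.Adj a b → Kᶜ.Adj a b := by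
      intro a b ha hb h
      rcases hcompl a b h with h | h | h
      · exact h
      · exact absurd h.2 hb
      · exact absurd h.1 ha
    have hbad : ∃ A p q C, l = A ++ p :: q :: C ∧ ((p = u ∧ q = v) ∨ (p = v ∧ q = u)) := by
      by_contra! hcon
      refine hKno ⟨l, ⟨?_, hl.2⟩, hall⟩
      rw [List.isChain_iff_forall_rel_of_append_cons_cons]
      intro a b l₁ l₂ he
      rcases hcompl a b (List.isChain_iff_forall_rel_of_append_cons_cons.1 hl.1 he) with h | h | h
      · exact h
      · exact absurd h.2 ((hcon l₁ a b l₂ he).1 h.1)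
      · exact absurd h.2 ((hcon l₁ a b l₂ he).2 h.1)
    obtain ⟨A, p, q, C, rfl, hpq⟩ := hbad
    have hc := List.isChain_append_cons_cons.1 hl.1
    have hnd := List.nodup_append.1 hl.2
    have h1 : p ∉ q :: C := (List.nodup_cons.1 hnd.2.1).1
    have h2 : q ∉ A ++ [p] := by
      intro h
      rcases List.mem_append.1 h with h | h
      · exact hnd.2.2 q h q (by simp) rfl
      · exact h1 (by simp_all)
    rcases hpq with ⟨rfl, rfl⟩ | ⟨rfl, rfl⟩
    · exact card_le_of_split hKno (isChain_compl_of_delete hv hc.1 h2)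
        (isChain_compl_of_delete hu hc.2.2 h1) hl.2 hall huv
    · rw [add_comm]
      exact card_le_of_split hKno (isChain_compl_of_delete hu hc.1 h2)
        (isChain_compl_of_delete hv hc.2.2 h1) hl.2 hall huv.symm

/-- If `H` has no path on `n` vertices and its complement has no Hamiltonian path, then `H` has a
set `D` of fewer than `n / 2` vertices, each adjacent to all but fewer than `|D|` others. It is the
neighbourhood of an end of a longest path in the closure of `H`. -/
lemma hamiltonian_or_dense {H : SimpleGraph V} {n : ℕ}
    (hfree : ∀ l, IsPathList H l → l.length < n) (hM : 2 * n ≤ Fintype.card V) :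
    (∃ l, IsPathList Hᶜ l ∧ ∀ x, x ∈ l) ∨
      ∃ D : Finset V, D.Nonempty ∧ 2 * D.card + 2 ≤ n ∧
        ∀ x ∈ D, Fintype.card V ≤ (nbr H x).card + D.card := by
  classical
  by_cases hno : ∃ l, IsPathList Hᶜ l ∧ ∀ x, x ∈ l
  · exact Or.inl hno
  right
  obtain ⟨K, hKH, ⟨u, v, huv⟩, hore⟩ := exists_closed_subgraph hno
  obtain ⟨l, hl, hmax⟩ := exists_longest (n := n) (p := IsPathList K) ⟨[u, v], by
    simpa using huv, by simpa using huv.ne⟩ (fun l hl => hfree l (hl.mono hKH))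
  have hlong : IsLongestThrough K ∅ ∅ l :=
    ⟨by rwa [deleteInside_empty], by simp, fun l' h _ => hmax l' (by rwa [deleteInside_empty] at h)⟩
  have hlen : 2 ≤ l.length := hmax [u, v] ⟨by simpa using huv, by simpa using huv.ne⟩
  have hsmall : ∀ l', IsLongestThrough K ∅ ∅ l' → ∀ x ∈ l'.head?, (nbr K x).card + 2 ≤ n := by
    intro l' hl' x hx
    have hsub : insert x (nbr K x) ⊆ l'.toFinset := by
      intro y hy
      rw [List.mem_toFinset]
      rcases Finset.mem_insert.1 hy with rfl | hy
      · exact List.mem_of_head? hx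
      · exact hl'.mem_of_adj_head (by simp) hx (mem_nbr.1 hy)
    have h1 := Finset.card_le_card hsub
    have h2 := hl'.path
    rw [deleteInside_empty] at h2
    rw [Finset.card_insert_of_notMem (by simp), List.toFinset_card_of_nodup h2.2] at h1
    have := hfree _ (h2.mono hKH)
    omega
  obtain ⟨a, b, t, rfl⟩ : ∃ a b t, l = a :: b :: t := by
    match l, hlen with
    | a :: b :: t, _ => exact ⟨a, b, t, rfl⟩
  have hab : K.Adj a b := (List.isChain_cons_cons.1 hl.1).1
  have ha := hsmall _ hlong a (by simp)
  have hbig : ∀ x ∈ nbr K a, n < (nbr K x).card + 2 := by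
    intro x hx
    have := hore a x (mem_nbr.1 hx)
    omega
  refine ⟨nbr K a, ⟨b, by simpa using hab⟩, ?_, fun x hx => ?_⟩
  · have := card_add_card_le (l := a :: b :: t) hl.2 (by simp) (S := nbr K a) (T := nbr K a)
      (fun x hx => hlong.mem_of_adj_head (by simp) (e := a) (by simp) (mem_nbr.1 hx))
      (fun x hx => hlong.mem_of_adj_head (by simp) (e := a) (by simp) (mem_nbr.1 hx)) ?_ ?_ ?_
    · have := hfree _ (hl.mono hKH)
      omega
    · intro x hx hxa
      have h1 := hsmall _ hlong.reverse x (by rwa [List.head?_reverse])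
      have := hbig x hxa
      omega
    · intro x hx
      have : x = a := by simpa using hx.symm
      subst this
      simp
    · intro l₁ x y l₂ he hx hy
      rw [he] at hlong
      have h1 := hsmall _ (hlong.rotate (e := a) (by rw [← he]; simp) (mem_nbr.1 hy) (by simp)) x
        (by simp)
      have := hbig x hx
      omega
  · have h1 := hore a x (mem_nbr.1 hx)
    have h2 := card_nbr_le_of_le hKH x
    omega

end Hamiltonian

/-! ### Monochromatic paths in a graph and its complement -/

section Monochromatic

variable {V : Type*} {H : SimpleGraph V}

/-- A nonempty path of `H` both ends of which satisfy `P`. -/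
structure IsSegment (H : SimpleGraph V) (P : V → Prop) (s : List V) : Prop where
  path : IsPathList H s
  ne_nil : s ≠ []
  head : ∀ w ∈ s.head?, P w
  last : ∀ w ∈ s.getLast?, P w

lemma isSegment_join {P : V → Prop} {s t : List V} (hs : IsSegment H P s) (ht : IsSegment H P t)
    {v w z : V} (hv : v ∈ s.head?) (hw : w ∈ t.head?) (hvz : H.Adj v z) (hwz : H.Adj w z)
    (hnd : (s.reverse ++ z :: t).Nodup) : IsSegment H P (s.reverse ++ z :: t) := by
  refine ⟨⟨List.isChain_append.2 ⟨hs.path.reverse.1, List.isChain_cons.2 ⟨?_, ht.path.1⟩, ?_⟩, hnd⟩,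
    by simp, ?_, ?_⟩
  · intro y hy
    obtain rfl : w = y := by simp_all
    exact hwz.symm
  · intro x hx y hy
    rw [List.getLast?_reverse] at hx
    obtain rfl : v = x := by simp_all
    obtain rfl : z = y := by simpa using hy
    exact hvz
  · intro x hx
    rw [List.head?_append, List.head?_reverse] at hx
    have h1 := hs.ne_nil
    rw [List.getLast?_eq_some_getLast h1] at hx
    exact hs.last x (by rw [List.getLast?_eq_some_getLast h1]; simpa using hx)
  · intro x hx
    have h1 := ht.ne_nil
    refine ht.last x ?_
    rw [List.getLast?_append, List.getLast?_cons, List.getLast?_eq_some_getLast h1] at hx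
    rw [List.getLast?_eq_some_getLast h1]
    simpa using hx

open Classical in
/-- Merging segments. Each disjoint pair of consecutive vertices `x`, `y` of `mid` merges two of the
segments: of three segment ends, two are adjacent to `x` or two are adjacent to `y`. -/
lemma exists_merged_segments {P : V → Prop} : ∀ (k : ℕ) (mid : List V) (segs : List (List V)),
    2 * k ≤ mid.length → segs.length = k + 2 → (∀ s ∈ segs, IsSegment H P s) →
    mid.IsChain (fun x y => ∀ w, P w → H.Adj w x ∨ H.Adj w y) →
    (∀ a, (segs.flatten ++ mid).count a ≤ 1) →
    ∃ s₁ s₂, IsSegment H P s₁ ∧ IsSegment H P s₂ ∧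
      (s₁ ++ s₂).length = segs.flatten.length + k ∧
      ∀ a, (s₁ ++ s₂).count a ≤ (segs.flatten ++ mid).count a
  | 0, mid, segs, _, hsegs, hseg, _, _ => by
    match segs, hsegs with
    | [s₁, s₂], _ =>
      refine ⟨s₁, s₂, hseg _ (by simp), hseg _ (by simp), by simp, fun a => ?_⟩
      simp only [List.flatten_cons, List.flatten_nil, List.append_nil, List.count_append]
      omega
  | k + 1, mid, segs, hmid, hsegs, hseg, hch, hcount => by
    match mid, segs, hmid, hsegs with
    | x :: y :: mid, s₁ :: s₂ :: s₃ :: segs, hmid, hsegs =>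
      have h₁ := hseg s₁ (by simp)
      have h₂ := hseg s₂ (by simp)
      have h₃ := hseg s₃ (by simp)
      -- merging two segments `s`, `t` through `z`, where `r` is the third segment
      have step : ∀ s t r : List V, IsSegment H P s → IsSegment H P t → IsSegment H P r →
          (∀ a, s.count a + t.count a + r.count a = s₁.count a + s₂.count a + s₃.count a) →
          s.length + t.length + r.length = s₁.length + s₂.length + s₃.length →
          ∀ v ∈ s.head?, ∀ w ∈ t.head?, ∀ z, z = x ∨ z = y → H.Adj v z → H.Adj w z →
          ∃ s₁' s₂', IsSegment H P s₁' ∧ IsSegment H P s₂' ∧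
            (s₁' ++ s₂').length = (s₁ :: s₂ :: s₃ :: segs).flatten.length + (k + 1) ∧
            ∀ a, (s₁' ++ s₂').count a ≤
              ((s₁ :: s₂ :: s₃ :: segs).flatten ++ x :: y :: mid).count a := by
        intro s t r hs ht hr hc hl v hv w hw z hz hvz hwz
        have hzc : ∀ a, [z].count a ≤ [x].count a + [y].count a := by
          intro a
          rcases hz with rfl | rfl <;> omega
        have hle : ∀ a, (((s.reverse ++ z :: t) :: r :: segs).flatten ++ mid).count a ≤
            ((s₁ :: s₂ :: s₃ :: segs).flatten ++ x :: y :: mid).count a := by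
          intro a
          have h1 := hc a
          have h2 := hzc a
          simp only [List.flatten_cons, List.count_append, List.count_cons, List.count_reverse,
            List.count_nil] at h1 h2 ⊢
          omega
        have hnd : (s.reverse ++ z :: t).Nodup := by
          rw [List.nodup_iff_count_le_one]
          intro a
          have h1 := (hle a).trans (hcount a)
          rw [List.flatten_cons, List.append_assoc, List.count_append] at h1
          omega
        have hj := isSegment_join hs ht hv hw hvz hwz hnd
        obtain ⟨p, q, hp, hq, hlen, hpq⟩ := exists_merged_segments k mid
          ((s.reverse ++ z :: t) :: r :: segs)
          (by simp only [List.length_cons] at hmid; omega)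
          (by simp only [List.length_cons] at hsegs ⊢; omega)
          (by
            intro s' hs'
            simp only [List.mem_cons] at hs'
            rcases hs' with rfl | rfl | hs'
            · exact hj
            · exact hr
            · exact hseg s' (by simp [hs']))
          (List.isChain_cons_cons.1 hch).2.tail
          (fun a => (hle a).trans (hcount a))
        refine ⟨p, q, hp, hq, ?_, fun a => (hpq a).trans (hle a)⟩
        rw [hlen]
        simp only [List.flatten_cons, List.length_append, List.length_cons, List.length_reverse]
        omega
      have hxy := (List.isChain_cons_cons.1 hch).1
      have hhead : ∀ s, IsSegment H P s → ∃ v, v ∈ s.head? ∧ (H.Adj v x ∨ H.Adj v y) := by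
        intro s hs
        have h := List.head?_eq_some_head hs.ne_nil
        exact ⟨_, h, hxy _ (hs.head _ h)⟩
      obtain ⟨v₁, hv₁, ha₁⟩ := hhead s₁ h₁
      obtain ⟨v₂, hv₂, ha₂⟩ := hhead s₂ h₂
      obtain ⟨v₃, hv₃, ha₃⟩ := hhead s₃ h₃
      have s12 := step s₁ s₂ s₃ h₁ h₂ h₃ (fun a => by omega) (by omega) v₁ hv₁ v₂ hv₂
      have s13 := step s₁ s₃ s₂ h₁ h₃ h₂ (fun a => by omega) (by omega) v₁ hv₁ v₃ hv₃
      have s23 := step s₂ s₃ s₁ h₂ h₃ h₁ (fun a => by omega) (by omega) v₂ hv₂ v₃ hv₃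
      rcases ha₁ with ha₁ | ha₁ <;> rcases ha₂ with ha₂ | ha₂
      · exact s12 x (Or.inl rfl) ha₁ ha₂
      · rcases ha₃ with ha₃ | ha₃
        · exact s13 x (Or.inl rfl) ha₁ ha₃
        · exact s23 y (Or.inr rfl) ha₂ ha₃
      · rcases ha₃ with ha₃ | ha₃
        · exact s23 x (Or.inl rfl) ha₂ ha₃
        · exact s13 y (Or.inr rfl) ha₁ ha₃
      · exact s12 y (Or.inr rfl) ha₁ ha₂

/-- If the path `Q` of `Hᶜ` is at least as long as every path of `H` and of `Hᶜ`, then at most half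
as many vertices lie off `Q` as on it. -/
lemma card_le_of_longest [Fintype V] {Q : List V} (hQ : IsPathList Hᶜ Q) (hp : 2 ≤ Q.length)
    (hmax : ∀ l, IsPathList H l → l.length ≤ Q.length)
    (hmax' : ∀ l, IsPathList Hᶜ l → l.length ≤ Q.length) :
    Fintype.card V ≤ Q.length + Q.length / 2 := by
  classical
  by_contra! hcard
  obtain ⟨a, mid, b, rfl⟩ : ∃ a mid b, Q = a :: (mid ++ [b]) := by
    match Q, hp with
    | a :: c :: t, _ =>
      exact ⟨a, (c :: t).dropLast, (c :: t).getLast (by simp),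
        by rw [List.dropLast_append_getLast]⟩
  set Q := a :: (mid ++ [b]) with hQdef
  set k := (Q.length - 2) / 2 with hk
  have hlenQ : Q.length = mid.length + 2 := by simp [hQdef]
  -- a vertex off `Q` cannot be put at either end of `Q`, nor between two consecutive vertices
  have hadj : ∀ w y, w ∉ Q → y ∈ Q → ¬Hᶜ.Adj w y → H.Adj w y := by
    intro w y hw hy h
    by_contra hcon
    exact h ((SimpleGraph.compl_adj _ _ _).2 ⟨fun h' => hw (h' ▸ hy), hcon⟩)
  have hwa : ∀ w, w ∉ Q → H.Adj w a := by
    intro w hw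
    refine hadj w a hw (by simp [hQdef]) fun h => ?_
    have := hmax' _ (hQ.cons hw (by simpa [hQdef] using h))
    simp at this
  have hwb : ∀ w, w ∉ Q → H.Adj w b := by
    intro w hw
    refine hadj w b hw (by simp [hQdef]) fun h => ?_
    have := hmax' _ (hQ.reverse.cons (u := w) (by simpa using hw) (by simpa [hQdef] using h))
    simp at this
  have hwc : mid.IsChain (fun x y => ∀ w, w ∉ Q → H.Adj w x ∨ H.Adj w y) := by
    rw [List.isChain_iff_forall_rel_of_append_cons_cons]
    intro x y l₁ l₂ he w hw
    by_contra! hcon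
    have hx : Hᶜ.Adj w x := by
      by_contra h
      exact hcon.1 (hadj w x hw (by simp [hQdef, he]) h)
    have hy : Hᶜ.Adj w y := by
      by_contra h
      exact hcon.2 (hadj w y hw (by simp [hQdef, he]) h)
    have he' : Q = (a :: l₁) ++ x :: y :: (l₂ ++ [b]) := by simp [hQdef, he]
    rw [he'] at hQ hw
    have hc := List.isChain_append_cons_cons.1 hQ.1
    have := hmax' ((a :: l₁) ++ x :: w :: y :: (l₂ ++ [b]))
      ⟨List.isChain_append_cons_cons.2 ⟨hc.1, hx.symm, List.isChain_cons_cons.2 ⟨hy, hc.2.2⟩⟩, by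
        have hp : ((a :: l₁) ++ x :: w :: y :: (l₂ ++ [b])).Perm
            (w :: ((a :: l₁) ++ x :: y :: (l₂ ++ [b]))) := by
          simpa using List.perm_middle (a := w) (l₁ := (a :: l₁) ++ [x]) (l₂ := y :: (l₂ ++ [b]))
        exact hp.nodup_iff.2 (List.nodup_cons.2 ⟨hw, hQ.2⟩)⟩
    rw [he'] at this
    simp at this
  -- start from single vertices off `Q`
  obtain ⟨W, hW, hWcard⟩ : ∃ W : Finset V, W ⊆ Finset.univ \ Q.toFinset ∧ W.card = k + 2 := by
    refine Finset.exists_subset_card_eq ?_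
    have := Finset.card_sdiff_add_card_eq_card (Finset.subset_univ Q.toFinset)
    rw [List.toFinset_card_of_nodup hQ.2, Finset.card_univ] at this
    omega
  have hWQ : ∀ w ∈ W.toList, w ∉ Q := by
    intro w hw
    have := hW (Finset.mem_toList.1 hw)
    simpa using this
  have hflat : (W.toList.map fun w => [w]).flatten = W.toList := by
    rw [← List.flatMap_def]; simp
  have hndall : (W.toList ++ Q).Nodup :=
    List.nodup_append.2 ⟨Finset.nodup_toList _, hQ.2, fun x hx y hy hxy =>
      hWQ x hx (hxy ▸ hy)⟩
  have hndall' : ∀ x, W.toList.count x + ([a].count x + mid.count x + [b].count x) ≤ 1 := by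
    intro x
    have := List.nodup_iff_count_le_one.1 hndall x
    rw [hQdef, List.count_append, List.count_cons, List.count_append] at this
    simp only [List.count_cons, List.count_nil] at this ⊢
    omega
  obtain ⟨s, t, hs, ht, hlen, hcount⟩ := exists_merged_segments (H := H) (P := fun w => w ∉ Q) k mid
    (W.toList.map fun w => [w]) (by omega) (by simp [hWcard]) (by
      intro s hs
      obtain ⟨w, hw, rfl⟩ := List.mem_map.1 hs
      exact ⟨⟨List.isChain_singleton _, by simp⟩, by simp, by simpa using hWQ w hw,
        by simpa using hWQ w hw⟩) hwc (by
      intro x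
      have := hndall' x
      rw [hflat, List.count_append]
      omega)
  rw [hflat] at hlen hcount
  have hpath : IsPathList H (s ++ a :: (t ++ [b])) := by
    refine ⟨List.isChain_append.2 ⟨hs.path.1, List.isChain_cons.2 ⟨?_, List.isChain_append.2
      ⟨ht.path.1, List.isChain_singleton _, ?_⟩⟩, ?_⟩, ?_⟩
    · intro y hy
      rw [List.head?_append, List.head?_eq_some_head ht.ne_nil] at hy
      refine (hwa y (ht.head y ?_)).symm
      rw [List.head?_eq_some_head ht.ne_nil]
      simpa using hy
    · intro x hx y hy
      obtain rfl : b = y := by simpa using hy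
      exact hwb x (ht.last x hx)
    · intro x hx y hy
      obtain rfl : a = y := by simpa using hy
      exact hwa x (hs.last x hx)
    · rw [List.nodup_iff_count_le_one]
      intro x
      have h1 := hcount x
      have h2 := hndall' x
      simp only [List.count_append, List.count_cons, List.count_nil] at h1 h2 ⊢
      omega
  have hfin := hmax _ hpath
  simp only [List.length_append, List.length_cons, Finset.length_toList, List.length_nil] at hlen hfin
  omega

/-- The diagonal case of the theorem of Gerencsér and Gyárfás on Ramsey numbers of paths. -/
lemma exists_monochromatic_path [Fintype V] (G : SimpleGraph V) {n : ℕ} (hn : 2 ≤ n)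
    (hM : n - 1 + (n + 1) / 2 ≤ Fintype.card V) :
    ∃ l : List V, l.length = n ∧ (IsPathList G l ∨ IsPathList Gᶜ l) := by
  by_contra! hcon
  have hb : ∀ l, IsPathList G l ∨ IsPathList Gᶜ l → l.length < n := by
    intro l hl
    by_contra! hlen
    have h := hcon (l.take n) (by simpa using hlen)
    rcases hl with hl | hl
    · exact h.1 (hl.take n)
    · exact h.2 (hl.take n)
  obtain ⟨Q, hQ, hmax⟩ := exists_longest (p := fun l => IsPathList G l ∨ IsPathList Gᶜ l)
    ⟨[], Or.inl ⟨List.isChain_nil, List.nodup_nil⟩⟩ hb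
  have hlen : 2 ≤ Q.length := by
    obtain ⟨x, y, hxy⟩ := Fintype.one_lt_card_iff.1 (show 1 < Fintype.card V by omega)
    refine hmax [x, y] ?_
    by_cases h : G.Adj x y
    · exact Or.inl ⟨by simpa using h, by simpa using hxy⟩
    · exact Or.inr ⟨by simpa [SimpleGraph.compl_adj] using ⟨hxy, h⟩, by simpa using hxy⟩
  have hlt := hb Q hQ
  rcases hQ with hQ | hQ
  · have := card_le_of_longest (H := Gᶜ) (by simpa using hQ) hlen (fun l hl => hmax l (Or.inr hl))
      (fun l hl => hmax l (Or.inl (by simpa using hl)))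
    omega
  · have := card_le_of_longest hQ hlen (fun l hl => hmax l (Or.inl hl))
      (fun l hl => hmax l (Or.inr hl))
    omega

end Monochromatic

/-! ### Alternating paths through vertices of large degree -/

section Alternating

variable {V : Type*} [Fintype V] [DecidableEq V] {G : SimpleGraph V}

/-- Vertices in `A ⊆ Z` with many common neighbours pairwise lie on a path that alternates between
`A` and vertices outside `Z ∪ F`, with a prescribed last vertex. -/
lemma exists_alternating {Z A F : Finset V} (hAZ : A ⊆ Z) {a₀ : V} (ha₀ : a₀ ∈ A) {c : ℕ}
    (hc : ∀ x ∈ A, ∀ y ∈ A, x ≠ y → c ≤ (nbr G x ∩ nbr G y).card)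
    (hcard : Z.card + F.card + A.card ≤ c + 1) :
    ∃ l, IsPathList (deleteInside G Z) l ∧ (∀ x ∈ A, x ∈ l) ∧ a₀ ∈ l.getLast? ∧
      (∀ x ∈ l, x ∈ A ∨ (x ∉ Z ∧ x ∉ F)) ∧ l.length + 1 = 2 * A.card := by
  have key : ∀ B : Finset V, B ⊆ A → a₀ ∉ B →
      ∃ l, IsPathList (deleteInside G Z) l ∧ (∀ x ∈ insert a₀ B, x ∈ l) ∧ a₀ ∈ l.getLast? ∧
      (∀ x ∈ l, x ∈ insert a₀ B ∨ (x ∉ Z ∧ x ∉ F)) ∧ l.length + 1 = 2 * (insert a₀ B).card ∧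
      ∃ h ∈ l.head?, h ∈ insert a₀ B := by
    intro B
    induction B using Finset.induction_on with
    | empty =>
      intro _ _
      exact ⟨[a₀], ⟨List.isChain_singleton _, by simp⟩, by simp, by simp, by simp, by simp,
        a₀, by simp, by simp⟩
    | insert x B hxB ih =>
      intro hB ha
      have hxA : x ∈ A := hB (Finset.mem_insert_self _ _)
      have hxa : x ≠ a₀ := fun h => ha (by simp [h])
      obtain ⟨l, hl, hBl, hlast, hmem, hlen, h, hhead, hhB⟩ :=
        ih (fun y hy => hB (Finset.mem_insert_of_mem hy)) (fun h => ha (by simp [h]))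
      have hsubA : insert a₀ (insert x B) ⊆ A := Finset.insert_subset ha₀ hB
      have hhA : h ∈ A := hsubA (by
        rcases Finset.mem_insert.1 hhB with h | h <;> simp [h])
      have hxB' : x ∉ insert a₀ B := by simp [hxa, hxB]
      have hcardB : (insert x (insert a₀ B)).card = (insert a₀ B).card + 1 :=
        Finset.card_insert_of_notMem hxB'
      have hcardA : (insert a₀ B).card + 1 ≤ A.card := by
        rw [← hcardB, Finset.insert_comm]
        exact Finset.card_le_card hsubA
      have hxl : x ∉ l := by
        intro hx
        rcases hmem x hx with h' | h'
        · exact hxB' h'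
        · exact h'.1 (hAZ hxA)
      -- a common neighbour of `x` and `h` that is still unused
      obtain ⟨y, hy, hyn⟩ : ∃ y ∈ nbr G x ∩ nbr G h, y ∉ Z ∪ F ∪ (l.toFinset \ insert a₀ B) := by
        refine Finset.exists_mem_notMem_of_card_lt_card ?_
        have h1 := hc x hxA h hhA (fun h' => hxB' (h' ▸ hhB))
        have h2 := Finset.card_union_le (Z ∪ F) (l.toFinset \ insert a₀ B)
        have h3 := Finset.card_union_le Z F
        have h4 : (l.toFinset \ insert a₀ B).card + (insert a₀ B).card = l.toFinset.card :=
          Finset.card_sdiff_add_card_eq_card (fun z hz => by simpa using hBl z hz)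
        rw [List.toFinset_card_of_nodup hl.2] at h4
        omega
      simp only [Finset.mem_inter, mem_nbr] at hy
      simp only [Finset.mem_union, Finset.mem_sdiff, List.mem_toFinset, not_or, not_and,
        not_not] at hyn
      have hinsZ : insert a₀ B ⊆ Z := fun z hz => hAZ (hsubA (by
        rcases Finset.mem_insert.1 hz with h | h <;> simp [h]))
      have hyl : y ∉ l := fun h' => hyn.1.1 (hinsZ (hyn.2 h'))
      have hxy : x ≠ y := fun h' => hyn.1.1 (h' ▸ hAZ hxA)
      refine ⟨x :: y :: l, ?_, ?_, ?_, ?_, ?_, x, by simp, by simp⟩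
      · refine IsPathList.cons (IsPathList.cons hl hyl ?_) (by simp [hxy, hxl]) ?_
        · intro z hz
          obtain rfl : h = z := by simp_all
          exact ⟨hy.2.symm, fun hh => hyn.1.1 hh.1⟩
        · intro z hz
          obtain rfl : y = z := by simpa using hz
          exact ⟨hy.1, fun hh => hyn.1.1 hh.2⟩
      · intro z hz
        simp only [Finset.mem_insert] at hz
        rcases hz with rfl | rfl | hz
        · exact List.mem_cons_of_mem _ (List.mem_cons_of_mem _ (hBl _ (by simp)))
        · simp
        · exact List.mem_cons_of_mem _ (List.mem_cons_of_mem _ (hBl _ (by simp [hz])))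
      · rw [List.getLast?_cons, List.getLast?_cons, Option.mem_def.1 hlast]
        simp
      · intro z hz
        simp only [List.mem_cons] at hz
        rcases hz with rfl | rfl | hz
        · simp
        · exact Or.inr ⟨hyn.1.1, hyn.1.2⟩
        · rcases hmem z hz with h' | h'
          · left
            rcases Finset.mem_insert.1 h' with h | h <;> simp [h]
          · exact Or.inr h'
      · rw [Finset.insert_comm, hcardB]
        simp only [List.length_cons]
        omega
  obtain ⟨l, h1, h2, h3, h4, h5, -⟩ := key (A.erase a₀) (Finset.erase_subset _ _) (by simp)
  rw [Finset.insert_erase ha₀] at h2 h4 h5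
  exact ⟨l, h1, h2, h3, h4, h5⟩

/-- A set `Y` of at most `n / 2` vertices lies on a path without consecutive vertices in `Y`, if it
splits into two parts such that two vertices of the same part have at least `n` common neighbours
and two vertices of different parts have more than `|Y|`. Only one step of the path goes from one
part to the other, hence the weaker bound. -/
lemma exists_path_through {X Y : Finset V} {n : ℕ} (hY : Y.Nonempty) (hYn : 2 * Y.card ≤ n)
    (h₁ : ∀ x ∈ Y ∩ X, ∀ y ∈ Y ∩ X, x ≠ y → n ≤ (nbr G x ∩ nbr G y).card)
    (h₂ : ∀ x ∈ Y \ X, ∀ y ∈ Y \ X, x ≠ y → n ≤ (nbr G x ∩ nbr G y).card)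
    (h₃ : ∀ x ∈ Y ∩ X, ∀ y ∈ Y \ X, Y.card < (nbr G x ∩ nbr G y).card) :
    ∃ l, IsPathList (deleteInside G Y) l ∧ ∀ x ∈ Y, x ∈ l := by
  have hcards := Finset.card_inter_add_card_sdiff Y X
  rcases (Y ∩ X).eq_empty_or_nonempty with hA | ⟨x₀, hx₀⟩
  · obtain ⟨y₀, hy₀⟩ := hY
    have hYX : Y \ X = Y := Finset.sdiff_eq_self_of_disjoint (Finset.disjoint_iff_inter_eq_empty.2 hA)
    rw [hYX] at h₂
    obtain ⟨l, hl, hYl, -⟩ := exists_alternating (F := ∅) (subset_refl Y) hy₀ h₂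
      (by simp only [Finset.card_empty]; omega)
    exact ⟨l, hl, hYl⟩
  rcases (Y \ X).eq_empty_or_nonempty with hB | ⟨y₀, hy₀⟩
  · have hYX : Y ∩ X = Y := Finset.inter_eq_left.2 (Finset.sdiff_eq_empty_iff_subset.1 hB)
    rw [hYX] at h₁ hx₀
    obtain ⟨l, hl, hYl, -⟩ := exists_alternating (F := ∅) (subset_refl Y) hx₀ h₁
      (by simp only [Finset.card_empty]; omega)
    exact ⟨l, hl, hYl⟩
  obtain ⟨z, hz, hzY⟩ := Finset.exists_mem_notMem_of_card_lt_card (h₃ x₀ hx₀ y₀ hy₀)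
  simp only [Finset.mem_inter, mem_nbr] at hz
  have hpos : 0 < (Y \ X).card := Finset.card_pos.2 ⟨y₀, hy₀⟩
  obtain ⟨l₁, hl₁, hYl₁, hlast₁, hmem₁, hlen₁⟩ := exists_alternating (F := {z})
    (Finset.inter_subset_left (s₁ := Y) (s₂ := X)) hx₀ h₁
    (by rw [Finset.card_singleton]; omega)
  have hF : (insert z (l₁.toFinset \ (Y ∩ X))).card ≤ (Y ∩ X).card := by
    have h4 : (l₁.toFinset \ (Y ∩ X)).card + (Y ∩ X).card = l₁.toFinset.card :=
      Finset.card_sdiff_add_card_eq_card (fun z hz => by simpa using hYl₁ z hz)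
    rw [List.toFinset_card_of_nodup hl₁.2] at h4
    have := Finset.card_insert_le z (l₁.toFinset \ (Y ∩ X))
    omega
  obtain ⟨l₂, hl₂, hYl₂, hlast₂, hmem₂, -⟩ := exists_alternating
    (F := insert z (l₁.toFinset \ (Y ∩ X))) (Finset.sdiff_subset (s := Y) (t := X)) hy₀ h₂
    (by omega)
  have hzl₁ : z ∉ l₁ := by
    intro h
    rcases hmem₁ z h with h' | h'
    · exact hzY (Finset.mem_inter.1 h').1
    · simp at h'
  have hzl₂ : z ∉ l₂ := by
    intro h
    rcases hmem₂ z h with h' | h'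
    · exact hzY (Finset.mem_sdiff.1 h').1
    · simp at h'
  refine ⟨l₁ ++ z :: l₂.reverse, ⟨List.isChain_append.2 ⟨hl₁.1, List.isChain_cons.2
    ⟨?_, hl₂.reverse.1⟩, ?_⟩, List.nodup_append.2 ⟨hl₁.2, List.nodup_cons.2
    ⟨by simpa using hzl₂, List.nodup_reverse.2 hl₂.2⟩, ?_⟩⟩, ?_⟩
  · intro y hy
    rw [List.head?_reverse] at hy
    obtain rfl : y₀ = y := by simp_all
    exact ⟨hz.2.symm, fun hh => hzY hh.1⟩
  · intro x hx y hy
    obtain rfl : x₀ = x := by simp_all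
    obtain rfl : z = y := by simpa using hy
    exact ⟨hz.1, fun hh => hzY hh.2⟩
  · rintro x hx y hy rfl
    simp only [List.mem_cons, List.mem_reverse] at hy
    rcases hy with rfl | hy
    · exact hzl₁ hx
    · rcases hmem₂ x hy with h' | h'
      · rcases hmem₁ x hx with h'' | h''
        · exact (Finset.mem_sdiff.1 h').2 (Finset.mem_inter.1 h'').2
        · exact h''.1 (Finset.mem_sdiff.1 h').1
      · have h5 := h'.2
        simp only [Finset.mem_insert, Finset.mem_sdiff, List.mem_toFinset, Finset.mem_inter,
          not_or, not_and] at h5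
        exact h5.2 hx fun hY => absurd hY h'.1
  · intro x hx
    by_cases hxX : x ∈ X
    · exact List.mem_append_left _ (hYl₁ x (Finset.mem_inter.2 ⟨hx, hxX⟩))
    · refine List.mem_append_right _ (List.mem_cons_of_mem _ (List.mem_reverse.2 ?_))
      exact hYl₂ x (Finset.mem_sdiff.2 ⟨hx, hxX⟩)

end Alternating

/-! ### A vertex with a long path in its non-neighbourhood -/

section Hub

variable {V : Type*}

lemma IsPathList.map_induce {G : SimpleGraph V} {s : Set V} {l : List s}
    (h : IsPathList (G.induce s) l) : IsPathList G (l.map Subtype.val) :=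
  ⟨List.isChain_map_of_isChain Subtype.val (fun _ _ h => h) h.1, h.2.map Subtype.val_injective⟩

lemma induce_compl_le (G : SimpleGraph V) (s : Set V) : (G.induce s)ᶜ ≤ Gᶜ.induce s := by
  intro a b h
  rw [SimpleGraph.compl_adj] at h
  exact (SimpleGraph.compl_adj _ _ _).2 ⟨fun h' => h.1 (Subtype.ext h'), h.2⟩

lemma card_le_inter [DecidableEq V] {A B S : Finset V} (hA : A ⊆ S) (hB : B ⊆ S) :
    A.card + B.card ≤ (A ∩ B).card + S.card := by
  have h1 := Finset.card_union_add_card_inter A B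
  have h2 := Finset.card_le_card (Finset.union_subset hA hB)
  omega

variable [Fintype V]

open Classical in
/-- The vertices of the connected component of `c`. -/
noncomputable def reach (G : SimpleGraph V) (c : V) : Finset V :=
  Finset.univ.filter (G.Reachable c)

@[simp] lemma mem_reach {G : SimpleGraph V} {c v : V} : v ∈ reach G c ↔ G.Reachable c v := by
  simp [reach]

/-- A list that meets a component but is too short to contain it has an edge leaving it. -/
lemma exists_adj_notMem_of_lt_reach {G : SimpleGraph V} {l : List V} {c : V}
    (h : l.length < (reach G c).card) (hc : c ∈ l) : ∃ v ∈ l, ∃ u, u ∉ l ∧ G.Adj v u := by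
  classical
  obtain ⟨w, hw, hwl⟩ := Finset.exists_mem_notMem_of_card_lt_card
    (show l.toFinset.card < (reach G c).card from l.toFinset_card_le.trans_lt h)
  obtain ⟨p⟩ := mem_reach.1 hw
  obtain ⟨d, -, hd₁, hd₂⟩ := p.exists_boundary_dart {x | x ∈ l} hc
    (by simpa using hwl : w ∉ {x | x ∈ l})
  exact ⟨d.fst, hd₁, d.snd, hd₂, d.adj⟩

lemma card_nbr_lt_reach (G : SimpleGraph V) (v : V) : (nbr G v).card + 1 ≤ (reach G v).card := by
  classical
  rw [← Finset.card_insert_of_notMem (show v ∉ nbr G v by simp)]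
  refine Finset.card_le_card fun x hx => ?_
  rcases Finset.mem_insert.1 hx with rfl | hx
  · simp
  · exact mem_reach.2 (mem_nbr.1 hx).reachable

/-- The version of `hamiltonian_or_dense` for the subgraph induced on a set of vertices. -/
lemma hamiltonian_or_dense_on [DecidableEq V] {G : SimpleGraph V} {n : ℕ}
    (hfree : ∀ l, IsPathList G l → l.length < n) {S : Finset V} (hS : 2 * n ≤ S.card) :
    (∃ l, IsPathList Gᶜ l ∧ l.length = S.card ∧ ∀ x ∈ l, x ∈ S) ∨
      ∃ D ⊆ S, D.Nonempty ∧ 2 * D.card + 2 ≤ n ∧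
        ∀ x ∈ D, S.card ≤ (nbr G x ∩ S).card + D.card := by
  have hfree' : ∀ l, IsPathList (G.induce (S : Set V)) l → l.length < n := fun l hl => by
    simpa using hfree _ hl.map_induce
  rcases hamiltonian_or_dense hfree' (by simpa using hS) with ⟨l, hl, hall⟩ | ⟨D, hD, hDn, hdeg⟩
  · left
    refine ⟨l.map Subtype.val, (hl.mono (induce_compl_le G _)).map_induce, ?_, ?_⟩
    · rw [List.length_map, ← List.toFinset_card_of_nodup hl.2,
        show l.toFinset = Finset.univ from Finset.eq_univ_iff_forall.2 fun x => by
          simpa using hall x]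
      simp
    · intro x hx
      obtain ⟨y, -, rfl⟩ := List.mem_map.1 hx
      exact y.2
  · right
    refine ⟨D.map (Function.Embedding.subtype _), ?_, by simpa using hD, by simpa using hDn, ?_⟩
    · intro x hx
      obtain ⟨y, -, rfl⟩ := Finset.mem_map.1 hx
      exact y.2
    · intro x hx
      obtain ⟨y, hy, rfl⟩ := Finset.mem_map.1 hx
      have h1 := hdeg y hy
      have h2 : nbr G y ∩ S = (nbr (G.induce (S : Set V)) y).map (Function.Embedding.subtype _) := by
        ext z
        simp only [Finset.mem_inter, mem_nbr, Finset.mem_map, Function.Embedding.coe_subtype]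
        constructor
        · rintro ⟨h, hz⟩
          exact ⟨⟨z, hz⟩, h, rfl⟩
        · rintro ⟨w, h, rfl⟩
          exact ⟨h, w.2⟩
      simp only [Function.Embedding.coe_subtype]
      rw [h2, Finset.card_map, Finset.card_map]
      simpa using h1

/-- If all components have fewer than `n` vertices, there are more than `b` of them, so some
component is small and some degree is less than `s`. -/
lemma exists_card_nbr_lt {G : SimpleGraph V} {n b s : ℕ} (hn : 2 ≤ n)
    (hcomp : ∀ c, (reach G c).card < n) (h₁ : (n - 1) * b + 1 ≤ Fintype.card V)
    (h₂ : Fintype.card V < (b + 1) * (s + 1)) : ∃ v, (nbr G v).card < s := by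
  classical
  by_contra! hcon
  set C : Finset G.ConnectedComponent := Finset.univ.image G.connectedComponentMk with hC
  have hsum : Fintype.card V = ∑ c ∈ C, (Finset.univ.filter
      fun v => G.connectedComponentMk v = c).card := by
    rw [← Finset.card_univ]
    exact Finset.card_eq_sum_card_image _ _
  have hfib : ∀ c ∈ C, s + 1 ≤ (Finset.univ.filter fun v => G.connectedComponentMk v = c).card ∧
      (Finset.univ.filter fun v => G.connectedComponentMk v = c).card ≤ n - 1 := by
    intro c hc
    obtain ⟨v, -, rfl⟩ := Finset.mem_image.1 hc
    have : (Finset.univ.filter fun u => G.connectedComponentMk u = G.connectedComponentMk v) =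
        reach G v := by
      ext u
      simp [SimpleGraph.ConnectedComponent.eq, SimpleGraph.reachable_comm]
    rw [this]
    have h3 := hcon v
    have h4 := card_nbr_lt_reach G v
    have h5 := hcomp v
    omega
  have h3 : C.card * (s + 1) ≤ Fintype.card V := by
    rw [hsum, ← smul_eq_mul]
    exact Finset.card_nsmul_le_sum _ _ _ fun c hc => (hfib c hc).1
  have h4 : Fintype.card V ≤ C.card * (n - 1) := by
    rw [hsum, ← smul_eq_mul]
    exact Finset.sum_le_card_nsmul _ _ _ fun c hc => (hfib c hc).2
  have h5 : b < C.card := by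
    by_contra! h
    have := Nat.mul_le_mul_right (n - 1) h
    rw [mul_comm b] at this
    omega
  have := Nat.mul_le_mul_right (s + 1) h5
  simp only [Nat.succ_eq_add_one] at this
  omega

lemma card_compl_insert [DecidableEq V] {v : V} {T : Finset V} (hv : v ∉ T) :
    (Finset.univ \ insert v T).card + T.card + 1 = Fintype.card V := by
  have := Finset.card_sdiff_add_card_eq_card (Finset.subset_univ (insert v T))
  rw [Finset.card_insert_of_notMem hv, Finset.card_univ] at this
  omega

lemma compl_adj_of_mem_sdiff [DecidableEq V] {G : SimpleGraph V} {v x : V} {T : Finset V}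
    (hT : nbr G v ⊆ T) (hx : x ∈ Finset.univ \ insert v T) : Gᶜ.Adj v x := by
  simp only [Finset.mem_sdiff, Finset.mem_univ, true_and, Finset.mem_insert, not_or] at hx
  exact (SimpleGraph.compl_adj _ _ _).2 ⟨fun h => hx.1 h.symm, fun h => hx.2 (hT (mem_nbr.2 h))⟩

/-- An obstruction to Hamiltonicity of the complement as produced by `hamiltonian_or_dense_on`: a
set `D` of fewer than `n / 2` vertices, each adjacent to all but fewer than `|D|` other vertices of
`S`, where `S` lacks at most `(2 * n - 1) / 3` vertices of `G`. -/
def IsObstruction [DecidableEq V] (G : SimpleGraph V) (n : ℕ) (S D : Finset V) : Prop :=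
  D ⊆ S ∧ 2 * D.card + 2 ≤ n ∧ (∀ x ∈ D, S.card ≤ (nbr G x ∩ S).card + D.card) ∧
    3 * Fintype.card V + 1 ≤ 3 * S.card + 2 * n

/-- The vertices of an obstruction, together with those having at most `n - 2` non-neighbours, lie
on a path without consecutive vertices of that kind; hence there are fewer than `n / 2` of them. -/
lemma IsObstruction.exists_path_through [DecidableEq V] {G : SimpleGraph V} {n : ℕ} {S D : Finset V}
    (h : IsObstruction G n S D) (hn : 2 ≤ n) (hN : 3 * n ≤ Fintype.card V + 2)
    (hfree : ∀ l, IsPathList G l → l.length < n) {Z : Finset V}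
    (hZ : ∀ x, x ∈ Z ↔ Fintype.card V + 1 ≤ (nbr G x).card + n ∨ x ∈ D) :
    2 * Z.card + 2 ≤ n ∧ (∀ z ∈ Z, n - 1 ≤ (nbr G z).card) ∧
      (Z.Nonempty → ∃ l, IsPathList (deleteInside G Z) l ∧ ∀ x ∈ Z, x ∈ l) := by
  obtain ⟨hDS, hDn, hD, hS⟩ := h
  set N := Fintype.card V with hNdef
  have hSN : S.card ≤ N := Finset.card_le_univ S
  have hDdeg : ∀ x ∈ D, S.card ≤ (nbr G x).card + D.card := fun x hx =>
    (hD x hx).trans (Nat.add_le_add_right (Finset.card_le_card Finset.inter_subset_left) _)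
  have hdeg : ∀ z ∈ Z, n - 1 ≤ (nbr G z).card := by
    intro z hz
    rcases (hZ z).1 hz with hz | hz
    · omega
    · have := hDdeg z hz
      omega
  set X : Finset V := Z.filter fun x => N + 1 ≤ (nbr G x).card + n with hX
  have hpath : ∀ Y ⊆ Z, Y.Nonempty → 2 * Y.card ≤ n →
      ∃ l, IsPathList (deleteInside G Y) l ∧ ∀ x ∈ Y, x ∈ l := by
    intro Y hYZ hY hYn
    have hYX : ∀ x ∈ Y ∩ X, N + 1 ≤ (nbr G x).card + n := fun x hx =>
      (Finset.mem_filter.1 (Finset.mem_inter.1 hx).2).2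
    have hYD : ∀ x ∈ Y \ X, x ∈ D := by
      intro x hx
      rw [Finset.mem_sdiff] at hx
      rcases (hZ x).1 (hYZ hx.1) with h | h
      · exact absurd (Finset.mem_filter.2 ⟨hYZ hx.1, h⟩) hx.2
      · exact h
    refine _root_.exists_path_through (X := X) hY hYn ?_ ?_ ?_
    · intro x hx y hy _
      have h1 := hYX x hx
      have h2 := hYX y hy
      have h3 := card_le_inter (Finset.subset_univ (nbr G x)) (Finset.subset_univ (nbr G y))
      rw [Finset.card_univ] at h3
      omega
    · intro x hx y hy _
      have h1 := hD x (hYD x hx)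
      have h2 := hD y (hYD y hy)
      have h3 := card_le_inter (Finset.inter_subset_right (s₁ := nbr G x) (s₂ := S))
        (Finset.inter_subset_right (s₁ := nbr G y) (s₂ := S))
      have h4 : (nbr G x ∩ S ∩ (nbr G y ∩ S)).card ≤ (nbr G x ∩ nbr G y).card :=
        Finset.card_le_card (Finset.inter_subset_inter Finset.inter_subset_left
          Finset.inter_subset_left)
      omega
    · intro x hx y hy
      have h1 := hYX x hx
      have h2 := hDdeg y (hYD y hy)
      have h3 := card_le_inter (Finset.subset_univ (nbr G x)) (Finset.subset_univ (nbr G y))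
      rw [Finset.card_univ] at h3
      omega
  have hout : ∀ Y ⊆ Z, Y.Nonempty → ∀ l, IsPathList G l → (∀ x ∈ Y, x ∈ l) →
      ∃ v ∈ l, ∃ u, u ∉ l ∧ G.Adj v u := by
    rintro Y hYZ ⟨y, hy⟩ l hl hYl
    obtain ⟨u, hu, hyu⟩ := exists_adj_notMem (hfree l hl) (hYl y hy) (hdeg y (hYZ hy))
    exact ⟨y, hYl y hy, u, hu, hyu⟩
  have hZn : 2 * Z.card + 2 ≤ n := by
    by_contra! hcon
    obtain ⟨Y, hYZ, hYc⟩ := Finset.exists_subset_card_eq (show n / 2 ≤ Z.card by omega)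
    have hY : Y.Nonempty := Finset.card_pos.1 (by omega)
    obtain ⟨e, -, -, h1, -⟩ := exists_end hfree (subset_refl Y) (fun z hz => hdeg z (hYZ hz))
      (hout Y hYZ hY) (hpath Y hYZ hY (by omega))
    have h2 := Finset.card_le_card (Finset.subset_union_right (s₁ := nbr G e) (s₂ := Y))
    omega
  exact ⟨hZn, hdeg, fun hne => hpath Z (subset_refl Z) hne (by omega)⟩

/-- The upper bound for `m ≥ 2 * n`: in a graph on `m + s` vertices without a path on `n` vertices,
some vertex has a path on `m` vertices of the complement among its non-neighbours. Here `b` plays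
the role of `β`. -/
theorem exists_hub_of_two_mul_le {G : SimpleGraph V} {n m s b : ℕ} (hn : 2 ≤ n) (hm : 2 * n ≤ m)
    (hfree : ∀ l, IsPathList G l → l.length < n) (hN : Fintype.card V = m + s)
    (hs : 2 * n < 3 * s + 4) (hb : (n - 1) * b + 1 ≤ Fintype.card V) (hb₃ : 3 ≤ b)
    (hms : m ≤ b * (s + 1)) :
    ∃ v l, l.length = m ∧ IsPathList Gᶜ l ∧ ∀ x ∈ l, Gᶜ.Adj v x := by
  classical
  have hN3 : 3 * n ≤ Fintype.card V + 2 := by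
    have := Nat.mul_le_mul_left (n - 1) hb₃
    omega
  by_cases hcomp : ∀ c, (reach G c).card < n
  · obtain ⟨v, hv⟩ := exists_card_nbr_lt hn hcomp hb (s := s) (by
      rw [add_mul]; omega)
    have hcard := card_compl_insert (show v ∉ nbr G v by simp)
    rcases hamiltonian_or_dense_on hfree (S := Finset.univ \ insert v (nbr G v)) (by omega) with
      ⟨l, hl, hlen, hlS⟩ | ⟨D, -, ⟨x, hx⟩, hDn, hD⟩
    · exact ⟨v, l.take m, by rw [List.length_take]; omega, hl.take m, fun x hx =>
        compl_adj_of_mem_sdiff (subset_refl _) (hlS x (List.mem_of_mem_take hx))⟩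
    · have h1 := hD x hx
      have h2 := Finset.card_le_card
        (Finset.inter_subset_left (s₁ := nbr G x) (s₂ := Finset.univ \ insert v (nbr G v)))
      have h3 := card_nbr_lt_reach G x
      have h4 := hcomp x
      omega
  · push Not at hcomp
    obtain ⟨c, hc⟩ := hcomp
    -- an obstruction with as many vertices as possible; the empty one is always available
    obtain ⟨⟨S, D⟩, hSD, hmax⟩ := Finset.exists_max_image
      (Finset.univ.filter fun p : Finset V × Finset V => IsObstruction G n p.1 p.2)
      (fun p => p.2.card) ⟨(Finset.univ, ∅), by simp [IsObstruction, hn]; omega⟩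
    have hobs : IsObstruction G n S D := (Finset.mem_filter.1 hSD).2
    set Z : Finset V := Finset.univ.filter
      fun x => Fintype.card V + 1 ≤ (nbr G x).card + n ∨ x ∈ D with hZ
    have hZmem : ∀ x, x ∈ Z ↔ Fintype.card V + 1 ≤ (nbr G x).card + n ∨ x ∈ D := by simp [hZ]
    obtain ⟨hZn, hZdeg, hZpath⟩ := hobs.exists_path_through hn hN3 hfree hZmem
    have hDZ : D.card ≤ Z.card := Finset.card_le_card fun x hx => (hZmem x).2 (Or.inr hx)
    obtain ⟨e, heZ, h1, h2⟩ : ∃ e, e ∉ Z ∧ (nbr G e ∪ Z).card + Z.card + 2 ≤ n ∧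
        3 * (nbr G e ∪ Z).card + 4 ≤ 2 * n := by
      rcases Z.eq_empty_or_nonempty with hZe | hZne
      · have hext : ∀ l, IsPathList G l → (∀ x ∈ ({c} : Finset V), x ∈ l) →
            ∃ v ∈ l, ∃ u, u ∉ l ∧ G.Adj v u := fun l hl hcl =>
          exists_adj_notMem_of_lt_reach ((hfree l hl).trans_le hc) (hcl c (by simp))
        obtain ⟨e, he, -, h⟩ := exists_end hfree (Z := Z) (R := {c}) (by simp [hZe]) hZdeg hext
          ⟨[c], ⟨List.isChain_singleton _, by simp⟩, by simp⟩
        exact ⟨e, he, h⟩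
      · have hext : ∀ l, IsPathList G l → (∀ x ∈ Z, x ∈ l) → ∃ v ∈ l, ∃ u, u ∉ l ∧ G.Adj v u := by
          intro l hl hZl
          obtain ⟨z, hz⟩ := hZne
          obtain ⟨u, hu, hzu⟩ := exists_adj_notMem (hfree l hl) (hZl z hz) (hZdeg z hz)
          exact ⟨z, hZl z hz, u, hu, hzu⟩
        obtain ⟨e, he, -, h⟩ := exists_end hfree (subset_refl Z) hZdeg hext (hZpath hZne)
        exact ⟨e, he, h⟩
    have hcard := card_compl_insert (show e ∉ nbr G e ∪ Z by simp [heZ])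
    rcases hamiltonian_or_dense_on hfree (S := Finset.univ \ insert e (nbr G e ∪ Z)) (by omega) with
      ⟨l, hl, hlen, hlS⟩ | ⟨D', hD'S, ⟨x, hx⟩, hDn, hD⟩
    · exact ⟨e, l.take m, by rw [List.length_take]; omega, hl.take m, fun x hx =>
        compl_adj_of_mem_sdiff Finset.subset_union_left (hlS x (List.mem_of_mem_take hx))⟩
    · exfalso
      -- `D'` is no larger than `D`, so its vertices have so few non-neighbours that they lie in `Z`
      have hobs' : IsObstruction G n (Finset.univ \ insert e (nbr G e ∪ Z)) D' :=
        ⟨hD'S, hDn, hD, by omega⟩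
      have h3 := hmax (_, D') (Finset.mem_filter.2 ⟨Finset.mem_univ _, hobs'⟩)
      have h4 := hD x hx
      have h5 := Finset.card_le_card (Finset.inter_subset_left (s₁ := nbr G x)
        (s₂ := Finset.univ \ insert e (nbr G e ∪ Z)))
      have h6 : x ∉ Z := by
        have := hD'S hx
        simp only [Finset.mem_sdiff, Finset.mem_insert, Finset.mem_union, not_or] at this
        exact this.2.2.2
      rw [hZmem] at h6
      simp only at h3
      push Not at h6
      omega

end Hub

/-! ### The hub in the case `m ≤ n` -/

section SmallForest

variable {V : Type*}

/-- A path alternating between two disjoint sets that are completely joined. -/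
lemma exists_bipartite_path [DecidableEq V] {H : SimpleGraph V} : ∀ (k : ℕ) (A B : Finset V),
    (∀ a ∈ A, ∀ b ∈ B, H.Adj a b) → k ≤ 2 * A.card → k ≤ 2 * B.card + 1 →
    ∃ l, IsPathList H l ∧ l.length = k ∧ (∀ x ∈ l, x ∈ A ∪ B) ∧ ∀ x ∈ l.head?, x ∈ A
  | 0, _, _, _, _, _ => ⟨[], ⟨List.isChain_nil, List.nodup_nil⟩, by simp⟩
  | k + 1, A, B, hAB, hA, hB => by
    obtain ⟨a, ha⟩ : A.Nonempty := Finset.card_pos.1 (by omega)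
    have hcard := Finset.card_erase_add_one ha
    obtain ⟨l, hl, hlen, hmem, hhead⟩ := exists_bipartite_path k B (A.erase a)
      (fun b hb x hx => (hAB x (Finset.mem_of_mem_erase hx) b hb).symm) (by omega) (by omega)
    have hal : a ∉ l := by
      intro h
      rcases Finset.mem_union.1 (hmem a h) with h | h
      · exact (hAB a ha a h).ne rfl
      · simp at h
    refine ⟨a :: l, hl.cons hal fun y hy => hAB a ha y (hhead y hy), by simp [hlen], ?_, ?_⟩
    · intro x hx
      rcases List.mem_cons.1 hx with rfl | hx
      · simp [ha]
      · rcases Finset.mem_union.1 (hmem x hx) with h | h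
        · simp [h]
        · simp [Finset.mem_of_mem_erase h]
    · intro x hx
      obtain rfl : a = x := by simpa using hx
      exact ha

lemma compl_adj_of_not_reachable {G : SimpleGraph V} {v x : V} (h : ¬G.Reachable v x) :
    Gᶜ.Adj v x :=
  (SimpleGraph.compl_adj _ _ _).2 ⟨fun h' => h (h' ▸ SimpleGraph.Reachable.refl v),
    fun h' => h h'.reachable⟩

variable [Fintype V]

/-- The upper bound for `m ≤ n`: in a graph on `2 * n - 1` vertices without a path on `n` vertices,
some vertex has a path on `n` vertices of the complement among its non-neighbours. If no degree is
small enough for `exists_monochromatic_path`, all components have more than `n / 2` and fewer than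
`n` vertices, so there are three of them. -/
theorem exists_hub_of_card_eq {G : SimpleGraph V} {n : ℕ} (hn : 2 ≤ n)
    (hfree : ∀ l, IsPathList G l → l.length < n) (hN : Fintype.card V = 2 * n - 1) :
    ∃ v l, l.length = n ∧ IsPathList Gᶜ l ∧ ∀ x ∈ l, Gᶜ.Adj v x := by
  classical
  by_cases hdeg : ∃ v, 2 * (nbr G v).card + 2 ≤ n
  · obtain ⟨v, hv⟩ := hdeg
    set S := Finset.univ \ insert v (nbr G v) with hS
    have hcard := card_compl_insert (show v ∉ nbr G v by simp)
    obtain ⟨l, hlen, hl | hl⟩ := exists_monochromatic_path (G.induce (S : Set V)) hn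
      (by rw [← hS] at hcard; simp only [Finset.coe_sort_coe, Fintype.card_coe]; omega)
    · have := hfree _ hl.map_induce
      simp [hlen] at this
    · refine ⟨v, l.map Subtype.val, by simpa using hlen,
        (hl.mono (induce_compl_le G _)).map_induce, fun x hx => ?_⟩
      obtain ⟨y, -, rfl⟩ := List.mem_map.1 hx
      exact compl_adj_of_mem_sdiff (subset_refl _) y.2
  · push Not at hdeg
    have hcomp : ∀ c, (reach G c).card < n := by
      intro c
      by_contra! hc
      obtain ⟨e, -, h, -⟩ := exists_end hfree (Z := ∅) (R := {c}) (by simp) (by simp)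
        (fun l hl hcl => exists_adj_notMem_of_lt_reach ((hfree l hl).trans_le hc) (hcl c (by simp)))
        ⟨[c], ⟨List.isChain_singleton _, by simp⟩, by simp⟩
      have := hdeg e
      omega
    have hbig : ∀ c, n ≤ 2 * (reach G c).card := fun c => by
      have h1 := hdeg c
      have h2 := card_nbr_lt_reach G c
      omega
    have hpos : 0 < Fintype.card V := by omega
    obtain ⟨v⟩ := Fintype.card_pos_iff.1 hpos
    obtain ⟨a, -, ha⟩ := Finset.exists_mem_notMem_of_card_lt_card
      (show (reach G v).card < (Finset.univ : Finset V).card by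
        have := hcomp v
        rw [Finset.card_univ]; omega)
    obtain ⟨b, -, hb⟩ := Finset.exists_mem_notMem_of_card_lt_card
      (show (reach G v ∪ reach G a).card < (Finset.univ : Finset V).card by
        have h1 := hcomp v
        have h2 := hcomp a
        have h3 := Finset.card_union_le (reach G v) (reach G a)
        rw [Finset.card_univ]; omega)
    simp only [Finset.mem_union, mem_reach, not_or] at ha hb
    obtain ⟨l, hl, hlen, hmem, -⟩ := exists_bipartite_path (H := Gᶜ) n (reach G a) (reach G b)
      (fun x hx y hy => compl_adj_of_not_reachable fun h => by
        rw [mem_reach] at hx hy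
        exact hb.2 ((hx.trans h).trans hy.symm)) (hbig a) (by have := hbig b; omega)
    refine ⟨v, l, hlen, hl, fun x hx => compl_adj_of_not_reachable fun h => ?_⟩
    have h1 := hmem x hx
    simp only [Finset.mem_union, mem_reach] at h1
    rcases h1 with h1 | h1
    · exact ha (h.trans h1.symm)
    · exact hb.1 (h.trans h1.symm)

end SmallForest

/-! ### Linear forests as subgraphs of paths -/

section LinearForest

variable {V W : Type*}

lemma eq_take_append_drop {l : List V} {i : ℕ} (hi : i + 1 < l.length) :
    l = l.take i ++ l[i] :: l[i + 1] :: l.drop (i + 2) := by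
  conv_lhs => rw [← List.take_append_drop i l]
  rw [List.drop_eq_getElem_cons (by omega : i < l.length), List.drop_eq_getElem_cons hi]

/-- The vertices of a linear forest can be listed such that adjacent vertices are consecutive. -/
lemma IsLinearForest.exists_list [Finite V] {F : SimpleGraph V} (hF : IsLinearForest F) :
    ∃ l : List V, l.Nodup ∧ (∀ x, x ∈ l) ∧ ∀ u v, F.Adj u v →
      ∃ l₁ l₂, l = l₁ ++ u :: v :: l₂ ∨ l = l₁ ++ v :: u :: l₂ := by
  classical
  have : Fintype F.ConnectedComponent := Fintype.ofFinite _
  choose k e using hF.2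
  let f : F.ConnectedComponent → List V := fun c =>
    (List.finRange (k c)).map fun i => ((e c).some.symm i).1
  have hmem : ∀ c x, x ∈ f c ↔ F.connectedComponentMk x = c := by
    intro c x
    simp only [f, List.mem_map, List.mem_finRange, true_and]
    constructor
    · rintro ⟨i, rfl⟩
      exact ((e c).some.symm i).2
    · intro hx
      exact ⟨(e c).some ⟨x, hx⟩, by simp⟩
  refine ⟨(Finset.univ : Finset F.ConnectedComponent).toList.flatMap f, ?_, ?_, ?_⟩
  · refine List.nodup_flatMap.2 ⟨fun c _ => ?_, ?_⟩
    · exact (List.nodup_finRange _).map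
        (Subtype.val_injective.comp (e c).some.symm.injective)
    · refine (Finset.nodup_toList _).imp fun {c d} hcd => ?_
      intro x hx hx'
      rw [hmem] at hx hx'
      exact hcd (hx.symm.trans hx')
  · intro x
    rw [List.mem_flatMap]
    exact ⟨F.connectedComponentMk x, by simp, (hmem _ _).2 rfl⟩
  · -- consecutive numbers in the path graph give consecutive entries of the list
    have key : ∀ c (i j : Fin (k c)), (i : ℕ) + 1 = j → ∃ l₁ l₂,
        (Finset.univ : Finset F.ConnectedComponent).toList.flatMap f =
        l₁ ++ ((e c).some.symm i).1 :: ((e c).some.symm j).1 :: l₂ := by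
      intro c i j hij
      obtain ⟨L₁, L₂, hL⟩ := List.append_of_mem
        (show c ∈ (Finset.univ : Finset F.ConnectedComponent).toList by simp)
      have hlen : (i : ℕ) + 1 < (f c).length := by simp [f, hij]
      have h1 := eq_take_append_drop hlen
      have h2 : (f c)[(i : ℕ)] = ((e c).some.symm i).1 := by simp [f]
      have h3 : (f c)[(i : ℕ) + 1] = ((e c).some.symm j).1 := by simp [f, hij]
      rw [h2, h3] at h1
      rw [hL, List.flatMap_append, List.flatMap_cons, h1]
      exact ⟨L₁.flatMap f ++ (f c).take i, (f c).drop (i + 2) ++ L₂.flatMap f, by simp⟩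
    intro u v huv
    set c := F.connectedComponentMk u with hc
    have hu : u ∈ c := rfl
    have hv : v ∈ c := (SimpleGraph.ConnectedComponent.connectedComponentMk_eq_of_adj huv).symm
    have hadj : (SimpleGraph.pathGraph (k c)).Adj ((e c).some ⟨u, hu⟩) ((e c).some ⟨v, hv⟩) :=
      (e c).some.map_rel_iff.2 huv
    rcases SimpleGraph.pathGraph_adj.1 hadj with h | h
    · obtain ⟨l₁, l₂, hl⟩ := key c _ _ h
      exact ⟨l₁, l₂, Or.inl (by simpa using hl)⟩
    · obtain ⟨l₁, l₂, hl⟩ := key c _ _ h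
      exact ⟨l₁, l₂, Or.inr (by simpa using hl)⟩

/-- A path on at least `|V|` vertices among the neighbours of `v` yields a copy of `K₁ ∨ F`, for a
linear forest `F` on `V`. -/
lemma join_isContained [Fintype V] {F : SimpleGraph V} (hF : IsLinearForest F) {H : SimpleGraph W}
    {v : W} {q : List W} (hlen : Fintype.card V ≤ q.length) (hq : IsPathList H q)
    (hv : ∀ x ∈ q, H.Adj v x) :
    graphJoin (SimpleGraph.completeGraph (Fin 1)) F ⊑ H := by
  classical
  obtain ⟨l, hnd, hall, hadj⟩ := hF.exists_list
  have hl : l.length = Fintype.card V := by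
    rw [← List.toFinset_card_of_nodup hnd, ← Finset.card_univ]
    congr 1
    ext x
    simp [hall x]
  have hidx : ∀ x, l.idxOf x < q.length := fun x =>
    (List.idxOf_lt_length_of_mem (hall x)).trans_le (hl.trans_le hlen)
  let φ : V → W := fun x => q[l.idxOf x]'(hidx x)
  have hφ : Function.Injective φ := by
    intro x y hxy
    have := (hq.2.getElem_inj_iff).1 hxy
    exact (List.idxOf_inj (hall x)).1 this
  have hvφ : ∀ x, H.Adj v (φ x) := fun x => hv _ (List.getElem_mem _)
  have hφadj : ∀ l₁ x y l₂, l = l₁ ++ x :: y :: l₂ → H.Adj (φ x) (φ y) := by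
    intro l₁ x y l₂ he
    have hnd' := hnd
    rw [he, List.nodup_append] at hnd'
    have hx : l.idxOf x = l₁.length := by
      rw [he, List.idxOf_append_of_notMem fun h => hnd'.2.2 x h x (by simp) rfl]
      simp
    have hxy : x ≠ y := fun h => (List.nodup_cons.1 hnd'.2.1).1 (by simp [h])
    have hy : l.idxOf y = l₁.length + 1 := by
      rw [he, List.idxOf_append_of_notMem fun h => hnd'.2.2 y h y (by simp) rfl,
        List.idxOf_cons_ne _ hxy]
      simp
    have h1 := hidx y
    have := List.isChain_iff_getElem.1 hq.1 l₁.length (by omega)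
    simpa only [φ, hx, hy] using this
  refine ⟨⟨⟨Sum.elim (fun _ => v) φ, ?_⟩, ?_⟩⟩
  · rintro (a | x) (b | y) h
    · have : a = b := Subsingleton.elim _ _
      subst this
      exact absurd rfl h.ne
    · exact hvφ y
    · exact (hvφ x).symm
    · have hxy : F.Adj x y := by simpa [graphJoin] using h
      obtain ⟨l₁, l₂, he | he⟩ := hadj x y hxy
      · exact hφadj _ _ _ _ he
      · exact (hφadj _ _ _ _ he).symm
  · rintro (a | x) (b | y) h
    · exact congrArg _ (Subsingleton.elim _ _)
    · exact absurd h (hvφ y).ne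
    · exact absurd h.symm (hvφ x).ne
    · exact congrArg _ (hφ h)

lemma length_lt_of_not_isContained {G : SimpleGraph V} {n : ℕ}
    (h : ¬SimpleGraph.pathGraph n ⊑ G) {l : List V} (hl : IsPathList G l) : l.length < n := by
  by_contra! hn
  refine h ⟨⟨⟨fun i => l[(i : ℕ)]'(i.2.trans_le hn), ?_⟩, ?_⟩⟩
  · intro i j hij
    have hc := List.isChain_iff_getElem.1 hl.1
    rcases SimpleGraph.pathGraph_adj.1 hij with h | h
    · simpa only [← h] using hc i (by omega)
    · simpa only [← h] using (hc j (by omega)).symm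
  · intro i j hij
    exact Fin.ext ((hl.2.getElem_inj_iff).1 hij)

end LinearForest

/-! ### Disjoint unions of cliques of nearly equal sizes -/

section Cliques

/-- The disjoint union of `b` cliques on `r` vertices: the residue classes modulo `b`. -/
def modGraph (r b : ℕ) : SimpleGraph (Fin r) where
  Adj i j := i ≠ j ∧ (i : ℕ) ≡ j [MOD b]
  symm.symm _ _ h := ⟨h.1.symm, h.2.symm⟩
  loopless.irrefl _ h := h.1 rfl

lemma modGraph_compl_adj {r b : ℕ} {i j : Fin r} (h : (modGraph r b)ᶜ.Adj i j) :
    ¬(i : ℕ) ≡ j [MOD b] := by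
  rw [SimpleGraph.compl_adj] at h
  exact fun h' => h.2 ⟨h.1, h'⟩

lemma not_pathGraph_isContained_modGraph {r b n N : ℕ} (hb : 0 < b) (hn : 2 ≤ n) (hr : r ≤ N)
    (hN : N ≤ (n - 1) * b) : ¬SimpleGraph.pathGraph n ⊑ modGraph r b := by
  rintro ⟨f⟩
  have hstep : ∀ (i : ℕ) (hi : i < n), (f ⟨i, hi⟩ : ℕ) ≡ (f ⟨0, by omega⟩ : ℕ) [MOD b] := by
    intro i
    induction i with
    | zero => intro _; rfl
    | succ i ih =>
      intro hi
      have h : (modGraph r b).Adj (f ⟨i, by omega⟩) (f ⟨i + 1, hi⟩) :=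
        f.toHom.map_adj (SimpleGraph.pathGraph_adj.2 (Or.inl rfl))
      exact h.2.symm.trans (ih (by omega))
  set v : ℕ := (f ⟨0, by omega⟩ : ℕ) with hv
  have hcard : n ≤ Nat.count (fun x => x ≡ v [MOD b]) N := by
    rw [Nat.count_eq_card_filter_range]
    calc n = (Finset.univ : Finset (Fin n)).card := by simp
      _ ≤ _ := by
        refine Finset.card_le_card_of_injOn (fun i => (f i : ℕ)) ?_ ?_
        · intro i _
          have := (f i).2
          simp only [Finset.coe_filter, Finset.mem_range, Set.mem_ofPred_eq]
          exact ⟨by omega, hstep i i.2⟩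
        · intro i _ j _ hij
          exact f.injective (Fin.ext hij)
  rw [Nat.count_modEq_card N hb] at hcard
  have h1 := Nat.div_add_mod N b
  have h2 : N / b ≤ n - 1 := Nat.div_le_of_le_mul (by rwa [mul_comm])
  split_ifs at hcard with h
  · have h3 : N / b = n - 1 := by omega
    rw [h3, mul_comm] at h1
    omega
  · omega

lemma not_join_isContained_modGraph {V : Type*} [Fintype V] {F : SimpleGraph V} {r b N : ℕ}
    (hb : 0 < b) (hr : r ≤ N) (hN : N + 1 ≤ Fintype.card V + N / b) :
    ¬graphJoin (SimpleGraph.completeGraph (Fin 1)) F ⊑ (modGraph r b)ᶜ := by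
  classical
  rintro ⟨f⟩
  set v : ℕ := (f (Sum.inl 0) : ℕ) with hv
  have hadj : ∀ x, ¬(f (Sum.inr x) : ℕ) ≡ v [MOD b] := by
    intro x h
    refine modGraph_compl_adj (f.toHom.map_adj (v := Sum.inl 0) (w := Sum.inr x) ?_) h.symm
    simp [graphJoin]
  have hcard : Fintype.card V ≤ ((Finset.range N).filter fun x => ¬x ≡ v [MOD b]).card := by
    rw [← Finset.card_univ]
    refine Finset.card_le_card_of_injOn (fun x => (f (Sum.inr x) : ℕ)) ?_ ?_
    · intro x _
      have := (f (Sum.inr x)).2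
      simp only [Finset.coe_filter, Finset.mem_range, Set.mem_ofPred_eq]
      exact ⟨by omega, hadj x⟩
    · intro x _ y _ hxy
      exact Sum.inr_injective (f.injective (Fin.ext hxy))
  have h1 := Finset.card_filter_add_card_filter_not (s := Finset.range N) (fun x => x ≡ v [MOD b])
  rw [← Nat.count_eq_card_filter_range, Nat.count_modEq_card N hb, Finset.card_range] at h1
  omega

lemma not_join_isContained_modGraph_two {V : Type*} {F : SimpleGraph V} (hF : F ≠ ⊥) {r : ℕ} :
    ¬graphJoin (SimpleGraph.completeGraph (Fin 1)) F ⊑ (modGraph r 2)ᶜ := by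
  rintro ⟨f⟩
  obtain ⟨x, y, hxy⟩ := SimpleGraph.ne_bot_iff_exists_adj.1 hF
  have h1 := modGraph_compl_adj (f.toHom.map_adj (v := Sum.inl 0) (w := Sum.inr x)
    (by simp [graphJoin]))
  have h2 := modGraph_compl_adj (f.toHom.map_adj (v := Sum.inl 0) (w := Sum.inr y)
    (by simp [graphJoin]))
  have h3 := modGraph_compl_adj (f.toHom.map_adj (v := Sum.inr x) (w := Sum.inr y)
    (by simpa [graphJoin] using hxy))
  simp only [Nat.ModEq] at h1 h2 h3
  omega

end Cliques

/-! ### The value of the Ramsey number -/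

/-- The cleared-denominator description of `t(k + 1, a + 1)`. -/
lemma exists_quasarT_eq {k a : ℕ} (hk : 0 < k) (ha : 0 < a) :
    ∃ b, 0 < b ∧ a ≤ b * k ∧ b * k < a + k ∧
      quasarT (k + 1) (a + 1) = if a * (b + 1) ≤ b ^ 2 * k then k * b + 1 else a / b + (a + 1) := by
  have hkQ : (0 : ℚ) < k := by exact_mod_cast hk
  have hα : quasarAlpha (k + 1) (a + 1) = (a : ℚ) / k := by simp [quasarAlpha]
  set b := quasarBeta (k + 1) (a + 1) with hb
  have hbα : b = ⌈(a : ℚ) / k⌉₊ := by rw [hb, quasarBeta, hα]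
  have hb0 : 0 < b := by
    rw [hbα, Nat.ceil_pos]
    positivity
  have hbQ : (0 : ℚ) < b := by exact_mod_cast hb0
  refine ⟨b, hb0, ?_, ?_, ?_⟩
  · have h := Nat.le_ceil ((a : ℚ) / k)
    rw [← hbα, div_le_iff₀ hkQ] at h
    exact_mod_cast h
  · have h := Nat.ceil_lt_add_one (show 0 ≤ (a : ℚ) / k by positivity)
    rw [← hbα, ← sub_lt_iff_lt_add, lt_div_iff₀ hkQ] at h
    have h' : (b : ℚ) * k < a + k := by linarith
    exact_mod_cast h'
  · have hiff : quasarAlpha (k + 1) (a + 1) ≤ quasarGamma (k + 1) (a + 1) ↔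
        a * (b + 1) ≤ b ^ 2 * k := by
      rw [hα, quasarGamma, ← hb, div_le_div_iff₀ hkQ (by positivity)]
      exact_mod_cast Iff.rfl
    have hfl : ⌊(((a + 1 : ℕ) : ℚ) - 1) / (b : ℚ)⌋₊ = a / b := by
      rw [← Nat.floor_div_eq_div (K := ℚ)]
      simp
    simp only [quasarT, ← hb, hiff, hfl, Nat.add_sub_cancel]

lemma isRamseyNumber_of_bounds {V : Type*} [Fintype V] {F : SimpleGraph V} (hF : IsLinearForest F)
    {n r : ℕ}
    (hup : ∀ G : SimpleGraph (Fin r), (∀ l, IsPathList G l → l.length < n) →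
      ∃ v l, Fintype.card V ≤ l.length ∧ IsPathList Gᶜ l ∧ ∀ x ∈ l, Gᶜ.Adj v x)
    (hlow : ∀ N < r, ∃ b, ¬SimpleGraph.pathGraph n ⊑ modGraph N b ∧
      ¬graphJoin (SimpleGraph.completeGraph (Fin 1)) F ⊑ (modGraph N b)ᶜ) :
    IsRamseyNumber (SimpleGraph.pathGraph n)
      (graphJoin (SimpleGraph.completeGraph (Fin 1)) F) r := by
  refine ⟨fun G => ?_, fun N hN => ?_⟩
  · by_cases h : SimpleGraph.pathGraph n ⊑ G
    · exact Or.inl h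
    · obtain ⟨v, l, hlen, hl, hv⟩ := hup G fun l hl => length_lt_of_not_isContained h hl
      exact Or.inr (join_isContained hF hlen hl hv)
  · by_contra! hlt
    obtain ⟨b, h₁, h₂⟩ := hlow N hlt
    rcases hN (modGraph N b) with h | h
    · exact h₁ h
    · exact h₂ h

/-- With `a = m - 1`, `k = n - 1` and `b = β`, this bounds the surplus `s = t(n, m) - m` from below:
it exceeds the size `U ≤ (2 * n - 4) / 3` of the sets `N(e) ∪ Z` provided by `exists_end`. -/
lemma two_mul_lt_of_le {k a b s : ℕ} (hk : 0 < k) (hb : 3 ≤ b) (h₁ : b * k < a + k)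
    (h₂ : a + 1 ≤ b * (s + 1)) : 2 * (k + 1) < 3 * s + 4 := by
  by_contra! hcon
  have h3 : b * (3 * (s + 1)) ≤ b * (2 * k + 1) := Nat.mul_le_mul_left b (by omega)
  have h4 : 3 * (k - 1) ≤ b * (k - 1) := Nat.mul_le_mul_right _ hb
  obtain ⟨j, rfl⟩ : ∃ j, k = j + 1 := ⟨k - 1, by omega⟩
  simp only [Nat.add_sub_cancel] at h4
  nlinarith

theorem theorem3 {V : Type*} [Fintype V] (F : SimpleGraph V) (hF : IsLinearForest F)
    (hne : F ≠ ⊥) (n m : ℕ) (hm : Fintype.card V = m) :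
    (2 ≤ m → m ≤ n →
      IsRamseyNumber (SimpleGraph.pathGraph n)
        (graphJoin (SimpleGraph.completeGraph (Fin 1)) F) (2 * n - 1)) ∧
    (2 ≤ n → 2 * n ≤ m →
      IsRamseyNumber (SimpleGraph.pathGraph n)
        (graphJoin (SimpleGraph.completeGraph (Fin 1)) F) (quasarT n m)) := by
  refine ⟨fun hm2 hmn => ?_, fun hn hnm => ?_⟩
  · refine isRamseyNumber_of_bounds hF (fun G hG => ?_) (fun N hN => ⟨2, ?_, ?_⟩)
    · obtain ⟨v, l, hlen, hl⟩ := exists_hub_of_card_eq (by omega) hG (Fintype.card_fin _)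
      exact ⟨v, l, by omega, hl⟩
    · exact not_pathGraph_isContained_modGraph two_pos (by omega) le_rfl (by omega)
    · exact not_join_isContained_modGraph_two hne
  · obtain ⟨k, rfl⟩ : ∃ k, n = k + 1 := ⟨n - 1, by omega⟩
    obtain ⟨a, rfl⟩ : ∃ a, m = a + 1 := ⟨m - 1, by omega⟩
    obtain ⟨b, hb, hab, hba, ht⟩ := exists_quasarT_eq (k := k) (a := a) (by omega) (by omega)
    have hb3 : 3 ≤ b := by
      by_contra! hb2
      have := Nat.mul_le_mul_right k (show b ≤ 2 by omega)
      omega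
    have hdiv := Nat.div_add_mod a b
    have hmod := Nat.mod_lt a hb
    rw [ht]
    split_ifs with hcase
    · -- `t(n, m) = (n - 1) * β + 1`
      obtain ⟨s, hs⟩ : ∃ s, k * b + 1 = a + 1 + s := ⟨k * b - a, by rw [mul_comm] at hab; omega⟩
      have has : a + 1 ≤ b * (s + 1) := by
        have : b * (k * b + 1) = b * (a + 1 + s) := by rw [hs]
        nlinarith
      refine isRamseyNumber_of_bounds hF (fun G hG => ?_) (fun N hN => ⟨b, ?_, ?_⟩)
      · obtain ⟨v, l, hlen, hl⟩ := exists_hub_of_two_mul_le (m := a + 1) (s := s) (b := b)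
          hn hnm hG (by rw [Fintype.card_fin, hs]) (two_mul_lt_of_le (by omega) hb3 hba has)
          (by rw [Fintype.card_fin]; simp) hb3 has
        exact ⟨v, l, by omega, hl⟩
      · exact not_pathGraph_isContained_modGraph (N := k * b) hb hn (by omega) (by simp)
      · refine not_join_isContained_modGraph (N := k * b) hb (by omega) ?_
        rw [hm, Nat.mul_div_cancel _ hb, mul_comm]
        omega
    · -- `t(n, m) = ⌊(m - 1) / β⌋ + m`
      set q := a / b with hq
      have has : a + 1 ≤ b * (q + 1) := by rw [mul_add]; omega
      have hqk : q ≤ k := Nat.div_le_of_le_mul hab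
      have hbq : k * b + 1 ≤ a + 1 + q := by
        by_contra! hcon
        have h1 : b * (a + q + 1) ≤ b * (k * b) := Nat.mul_le_mul_left b (by omega)
        nlinarith
      refine isRamseyNumber_of_bounds hF (fun G hG => ?_) (fun N hN => ⟨b + 1, ?_, ?_⟩)
      · obtain ⟨v, l, hlen, hl⟩ := exists_hub_of_two_mul_le (m := a + 1) (s := q) (b := b)
          hn hnm hG (by rw [Fintype.card_fin, add_comm]) (two_mul_lt_of_le (by omega) hb3 hba has)
          (by rw [Fintype.card_fin]; simp only [Nat.add_sub_cancel]; omega) hb3 has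
        exact ⟨v, l, by omega, hl⟩
      · refine not_pathGraph_isContained_modGraph (N := q + a) (by omega) hn (by omega) ?_
        simp only [Nat.add_sub_cancel]
        rw [mul_add, mul_comm k b]
        omega
      · refine not_join_isContained_modGraph (N := q + a) (by omega) (by omega) ?_
        have : q ≤ (q + a) / (b + 1) := by
          rw [Nat.le_div_iff_mul_le (by omega), mul_add, mul_comm q b]
          omega
        omega
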